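/- **The graph.** For integers $n,r,s,t\ge 1$ let $G_{n,r,s,t}$ be the following acyclic directed multigraph with edge costs. Put $\epsilon=1/(rs)$. The vertices are the target $\mathsf t=u_{n+1}=w_{n+1}$ and, for $i\in[n]$, the vertices $u_i$, $w_i$, $a_{i,j,k}$ ($j\in[r]$, $k\in[s]$) and $b_{i,j}$ ($j\in[rs]$). For convenience write $a_{i,j,s+1}=b_{i,1}$ and $b_{i,rs+1}=w_{i+1}$. The edges are, for all $i\in[n]$: - *one-edges*, all of cost $0$: a single edge $a_{i,j,k}\to a_{i,j,k+1}$ for $j\in[r],k\in[s]$; a single edge $b_{i,j}\to b_{i,j+1}$ for $j\in[rs]$; $t$ parallel edges $u_i\to b_{i,1}$; $t$ parallel edges $w_i\to a_{i,j,1}$ for each $j\in[r]$; - *zero-edges*, each with $t$ parallel copies: $a_{i,j,k}\to u_{i+1}$ of cost $2^{2i+1}+(k-1)\epsilon$ for $j\in[r],k\in[s]$; $b_{i,j}\to u_{i+1}$ of cost $2^{2i+1}+1+(j-1)\epsilon$ for $j\in[rs]$; $u_i\to u_{i+1}$ of cost $2^{2i}$; $w_i\to w_{i+1}$ of cost $2^{2i}$.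 **The algorithm.** A *tree* $B$ consists of exactly one outgoing edge of every vertex other than $\mathsf t$, such that following these edges leads from every vertex to $\mathsf t$; $y_B(v)$ is the cost of the path from $v$ to $\mathsf t$ in $B$. An edge $e=(u,v)$ is an *improving switch* with respect to $B$ if $c(e)+y_B(v)<y_B(u)$, and $B[e]$ is obtained from $B$ by replacing its edge that leaves $u$ by $e$. $\text{Random-Facet}(F,B)$, for a set $F$ of edges and a tree $B\subseteq F$, does the following. If $F=B$, it returns $B$. Otherwise it picks $e\in F\setminus B$ uniformly at random and calls $\text{Random-Facet}(F\setminus\{e\},B)$, which returns a tree $B'$. If $e$ is an improving switch with respect to $B'$, it performs this switch and returns the result of $\text{Random-Facet}(F,B'[e])$; otherwise it returns $B'$. All random choices are independent. **Theorem.** Let $r,s,t:\mathbb N\to\mathbb N$ satisfy $r(n)=\Theta(\log n)$, $s(n)=\Theta(\sqrt n\,\log n)$ and $t(n)=\Theta(\log n)$, and let $E$ be the edge set of $G_{n,r(n),s(n),t(n)}$ and $M=|E|$. Then $\sqrt n=\Theta(M^{1/3}/\log M)$, and there is a constant $c>0$ such that for all sufficiently large $n$ and for every tree $B_0$ of $G_{n,r(n),s(n),t(n)}$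 that consists entirely of zero-edges, the expected number of improving switches performed by $\text{Random-Facet}(E,B_0)$ is at least $e^{c\sqrt n}$ and at least $e^{c\,M^{1/3}/\log M}$. -/

import Mathlib

open Filter Asymptotics
open scoped ENNReal

/-- A directed multigraph with vertices `V`, edges `E`, real edge costs and a target vertex:
an instance of the problem of finding shortest paths from all vertices to the target. -/
structure PathInstance (V E : Type) where
  src : E → V
  dst : E → V
  cost : E → ℝ
  target : V

namespace PathInstance

variable {V E : Type} (G : PathInstance V E)

/-- `G.PathCost B v x`: some path of edges of `B` leads from `v` to the target and has total
cost `x`. If `B` is a tree, then `x` is unique, and it is the value `y_B(v)`. -/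
inductive PathCost (B : Finset E) : V → ℝ → Prop
  | target : PathCost B G.target 0
  | step (e : E) (x : ℝ) : e ∈ B → PathCost B (G.dst e) x →
      PathCost B (G.src e) (G.cost e + x)

/-- `B` is a tree directed towards the target: exactly one edge of `B` leaves every vertex other
than the target, none leaves the target, and every vertex reaches the target inside `B`. -/
def IsTree (B : Finset E) : Prop :=
  (∀ v, v ≠ G.target → ∃! e, e ∈ B ∧ G.src e = v) ∧
  (∀ e ∈ B, G.src e ≠ G.target) ∧
  ∀ v, ∃ x, G.PathCost B v x

/-- The edge `e = (u, v)` is an improving switch with respect to `B`: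
`c(e) + y_B(v) < y_B(u)`. -/
def Improving (B : Finset E) (e : E) : Prop :=
  ∃ x y, G.PathCost B (G.src e) x ∧ G.PathCost B (G.dst e) y ∧ G.cost e + y < x

open Classical in
/-- `B[e]`: the edge of `B` that leaves the tail of `e` is replaced by `e`. -/
noncomputable def switch (B : Finset E) (e : E) : Finset E :=
  insert e (B.filter fun e' => G.src e' ≠ G.src e)

end PathInstance

/-- Binary computation trees. A node stands for a recursive call of Random-Facet; it is a leaf,
or it is labelled with the edge picked by the call and has either a left child only, or a left
and a right child. -/
inductive CompTree (E : Type) : Type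
  | leaf : CompTree E
  | left (e : E) (l : CompTree E) : CompTree E
  | both (e : E) (l r : CompTree E) : CompTree E

namespace CompTree

variable {V E : Type} (G : PathInstance V E)

/-- The number of nodes that have a right child, that is, of improving switches performed. -/
def numSwitches : CompTree E → ℕ
  | leaf => 0
  | left _ l => l.numSwitches
  | both _ l r => l.numSwitches + 1 + r.numSwitches

/-- The tree returned by a call with current tree `B` whose computation tree is given. -/
noncomputable def result : Finset E → CompTree E → Finset E
  | B, leaf => B
  | B, left _ l => result B l
  | B, both e l r => result (G.switch (result B l) e) r

/-- The given computation tree can be generated by the call `Random-Facet(F, B)`: if `F = B`, the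
call stops; otherwise it picks `e ∈ F \ B` and calls `Random-Facet(F \ {e}, B)`, which returns
`B'`; if `e` is an improving switch with respect to `B'`, then it calls
`Random-Facet(F, B'[e])`, otherwise it stops. -/
def IsRun [DecidableEq E] : Finset E → Finset E → CompTree E → Prop
  | F, B, leaf => F = B
  | F, B, left e l => e ∈ F \ B ∧ IsRun (F.erase e) B l ∧ ¬ G.Improving (result G B l) e
  | F, B, both e l r => e ∈ F \ B ∧ IsRun (F.erase e) B l ∧ G.Improving (result G B l) e ∧
      IsRun F (G.switch (result G B l) e) r

/-- The probability that `Random-Facet(F, B)` generates the given computation tree: every call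
picks its edge uniformly at random from `F \ B`, independently of all other choices. -/
noncomputable def prob [DecidableEq E] : Finset E → Finset E → CompTree E → ℝ≥0∞
  | _, _, leaf => 1
  | F, B, left e l => ((F \ B).card : ℝ≥0∞)⁻¹ * prob (F.erase e) B l
  | F, B, both e l r => ((F \ B).card : ℝ≥0∞)⁻¹ * prob (F.erase e) B l *
      prob F (G.switch (result G B l) e) r

end CompTree

/-- The expected number of improving switches performed by `Random-Facet(F, B)`. -/
noncomputable def expectedSwitches {V E : Type} [DecidableEq E] (G : PathInstance V E)
    (F B : Finset E) : ℝ≥0∞ :=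
  ∑' T : {T : CompTree E // CompTree.IsRun G F B T},
    CompTree.prob G F B T.1 * (T.1.numSwitches : ℝ≥0∞)

/-- The vertices of `G_{n,r,s,t}`. Indices start at `0`, so that `u i` stands for `u_{i+1}`,
and so on. -/
inductive CVertex (n r s : ℕ) : Type
  | target
  | u (i : Fin n)
  | w (i : Fin n)
  | a (i : Fin n) (j : Fin r) (k : Fin s)
  | b (i : Fin n) (j : Fin (r * s))

/-- The edges of `G_{n,r,s,t}`; the last argument `l : Fin t` numbers the copies of a
multi-edge. -/
inductive CEdge (n r s t : ℕ) : Type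
  | a1 (i : Fin n) (j : Fin r) (k : Fin s)
  | a0 (i : Fin n) (j : Fin r) (k : Fin s) (l : Fin t)
  | b1 (i : Fin n) (j : Fin (r * s))
  | b0 (i : Fin n) (j : Fin (r * s)) (l : Fin t)
  | u1 (i : Fin n) (l : Fin t)
  | u0 (i : Fin n) (l : Fin t)
  | wj (i : Fin n) (j : Fin r) (l : Fin t)
  | w0 (i : Fin n) (l : Fin t)
  deriving DecidableEq, Fintype

namespace CVertex

variable {n r s : ℕ}

/-- The vertex `u` of the next level; after the last level, it is the target. -/
def uNext (i : Fin n) : CVertex n r s :=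
  if h : i.val + 1 < n then u ⟨i.val + 1, h⟩ else target

/-- The vertex `w` of the next level; after the last level, it is the target. -/
def wNext (i : Fin n) : CVertex n r s :=
  if h : i.val + 1 < n then w ⟨i.val + 1, h⟩ else target

/-- The first vertex of the `b`-path of a level (for `r, s ≥ 1`; otherwise it does not exist and
the target serves as a placeholder). -/
def bFirst (i : Fin n) : CVertex n r s :=
  if h : 0 < r * s then b i ⟨0, h⟩ else target

/-- The first vertex of the `j`-th `a`-path of a level (for `s ≥ 1`; otherwise it does not exist
and the target serves as a placeholder). -/
def aFirst (i : Fin n) (j : Fin r) : CVertex n r s :=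
  if h : 0 < s then a i j ⟨0, h⟩ else target

end CVertex

namespace CEdge

variable {n r s t : ℕ}

/-- The zero-edges (superscript `0`); the remaining edges are the one-edges. -/
def IsZero : CEdge n r s t → Prop
  | a0 _ _ _ _ => True
  | b0 _ _ _ => True
  | u0 _ _ => True
  | w0 _ _ => True
  | _ => False

def src : CEdge n r s t → CVertex n r s
  | a1 i j k => .a i j k
  | a0 i j k _ => .a i j k
  | b1 i j => .b i j
  | b0 i j _ => .b i j
  | u1 i _ => .u i
  | u0 i _ => .u i
  | wj i _ _ => .w i
  | w0 i _ => .w i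

def dst : CEdge n r s t → CVertex n r s
  | a1 i j k => if h : k.val + 1 < s then .a i j ⟨k.val + 1, h⟩ else .bFirst i
  | a0 i _ _ _ => .uNext i
  | b1 i j => if h : j.val + 1 < r * s then .b i ⟨j.val + 1, h⟩ else .wNext i
  | b0 i _ _ => .uNext i
  | u1 i _ => .bFirst i
  | u0 i _ => .uNext i
  | wj i j _ => .aFirst i j
  | w0 i _ => .wNext i

/-- The costs, with `ε = 1 / (r s)`; the level that `i : Fin n` stands for is `i + 1`. -/
noncomputable def cost : CEdge n r s t → ℝ
  | a1 _ _ _ => 0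
  | a0 i _ k _ => 2 ^ (2 * (i.val + 1) + 1) + (k.val : ℝ) * (1 / ((r : ℝ) * s))
  | b1 _ _ => 0
  | b0 i j _ => 2 ^ (2 * (i.val + 1) + 1) + 1 + (j.val : ℝ) * (1 / ((r : ℝ) * s))
  | u1 _ _ => 0
  | u0 i _ => 2 ^ (2 * (i.val + 1))
  | wj _ _ _ => 0
  | w0 i _ => 2 ^ (2 * (i.val + 1))

end CEdge

/-- The shortest-path instance `G_{n,r,s,t}`. -/
noncomputable def counterGraph (n r s t : ℕ) :
    PathInstance (CVertex n r s) (CEdge n r s t) where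
  src := CEdge.src
  dst := CEdge.dst
  cost := CEdge.cost
  target := CVertex.target

/-- The number `M` of edges of `G_{n,r,s,t}`. -/
def numEdges (n r s t : ℕ) : ℕ := Fintype.card (CEdge n r s t)

/-!
Random-Facet on this graph behaves like a randomized binary counter. The bit of a level is set once
the tree uses the `b`-path of the level. This makes its vertex `u` cheaper than its vertex `w`, so
that all lower levels leave their `b`-paths and their bits are reset; completing an `a`-path of the
level makes `w` as cheap as `u`, and the lower levels can count again. Random-Facet first removes
edges. When it removes an edge of the `b`-path of one of the `g` highest active levels, it counts
twice: once without this level, and once more, with the lower levels, after the removed edge has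
been switched in. Hence the number of switches doubles with every bit.

Removing edges also does harm: levels get lost, and the copies of a multi-edge or the `a`-paths of a
level may run out. This is measured by potentials such as the sum of `p ^ (number of copies)`, whose
expected increase per removed edge is proportional to the potential itself; discounting the value by
`K` per bit and by `η` per interrupted `a`-path absorbs the increase. With `√n / A` bits, for a
large constant `A`, the total loss stays below a constant fraction, so that about `2 ^ (√n / A)`
switches remain.
-/

namespace PathInstance

variable {V E : Type} {G : PathInstance V E} {B F : Finset E}

/-- `rank` certifies that `G` is acyclic: it decreases along every edge, and no edge leaves the
target. -/
structure IsRanked (G : PathInstance V E) (rank : V → ℕ) : Prop where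
  src_ne : ∀ e, G.src e ≠ G.target
  lt : ∀ e, rank (G.dst e) < rank (G.src e)

theorem PathCost.eq_target_or_exists {v : V} {x : ℝ} (h : G.PathCost B v x) :
    (v = G.target ∧ x = 0) ∨
      ∃ e y, e ∈ B ∧ G.src e = v ∧ G.PathCost B (G.dst e) y ∧ x = G.cost e + y := by
  cases h with
  | target => exact Or.inl ⟨rfl, rfl⟩
  | step e y he hy => exact Or.inr ⟨e, y, he, rfl, hy, rfl⟩

theorem IsTree.eq_of_src_eq (hB : G.IsTree B) {e e' : E} (he : e ∈ B) (he' : e' ∈ B)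
    (h : G.src e = G.src e') : e = e' :=
  (hB.1 (G.src e') (hB.2.1 e' he')).unique ⟨he, h⟩ ⟨he', rfl⟩

theorem IsTree.pathCost_unique (hB : G.IsTree B) {v : V} {x : ℝ} (hx : G.PathCost B v x) :
    ∀ {y : ℝ}, G.PathCost B v y → x = y := by
  induction hx with
  | target =>
    intro y hy
    rcases hy.eq_target_or_exists with ⟨-, h⟩ | ⟨e, _, he, hs, -⟩
    · exact h.symm
    · exact absurd hs (hB.2.1 e he)
  | step e x he _ ih =>
    intro y hy
    rcases hy.eq_target_or_exists with ⟨h, -⟩ | ⟨e', z, he', hs, hz, rfl⟩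
    · exact absurd h (hB.2.1 e he)
    · obtain rfl := hB.eq_of_src_eq he' he hs
      rw [ih hz]

open Classical in
/-- The cost of the path from `v` to the target in the tree `B`. -/
noncomputable def dist (G : PathInstance V E) (B : Finset E) (v : V) : ℝ :=
  if h : ∃ x, G.PathCost B v x then h.choose else 0

theorem IsTree.pathCost_dist (hB : G.IsTree B) (v : V) : G.PathCost B v (G.dist B v) := by
  have h := hB.2.2 v
  rw [dist, dif_pos h]
  exact h.choose_spec

theorem IsTree.dist_eq (hB : G.IsTree B) {v : V} {x : ℝ} (h : G.PathCost B v x) :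
    G.dist B v = x :=
  hB.pathCost_unique (hB.pathCost_dist v) h

theorem IsTree.dist_target (hB : G.IsTree B) : G.dist B G.target = 0 :=
  hB.dist_eq PathCost.target

theorem IsTree.dist_src (hB : G.IsTree B) {e : E} (he : e ∈ B) :
    G.dist B (G.src e) = G.cost e + G.dist B (G.dst e) :=
  hB.dist_eq (PathCost.step e _ he (hB.pathCost_dist _))

theorem IsTree.improving_iff (hB : G.IsTree B) {e : E} :
    G.Improving B e ↔ G.cost e + G.dist B (G.dst e) < G.dist B (G.src e) := by
  constructor
  · rintro ⟨x, y, hx, hy, h⟩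
    rwa [hB.dist_eq hx, hB.dist_eq hy]
  · intro h
    exact ⟨_, _, hB.pathCost_dist _, hB.pathCost_dist _, h⟩

theorem mem_switch {e e' : E} :
    e' ∈ G.switch B e ↔ e' = e ∨ (e' ∈ B ∧ G.src e' ≠ G.src e) := by
  classical
  simp [switch]

theorem switch_subset {e : E} (hF : B ⊆ F) (he : e ∈ F) : G.switch B e ⊆ F := by
  intro e' h
  rcases mem_switch.1 h with rfl | h
  · exact he
  · exact hF h.1

variable {rank : V → ℕ}

theorem IsRanked.exists_pathCost (hG : G.IsRanked rank)
    (h : ∀ v, v ≠ G.target → ∃ e ∈ B, G.src e = v) (v : V) : ∃ x, G.PathCost B v x := by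
  induction hn : rank v using Nat.strong_induction_on generalizing v with
  | _ m ih =>
    by_cases hv : v = G.target
    · subst hv
      exact ⟨0, PathCost.target⟩
    · obtain ⟨e, he, rfl⟩ := h v hv
      obtain ⟨x, hx⟩ := ih _ (hn ▸ hG.lt e) (G.dst e) rfl
      exact ⟨_, PathCost.step e x he hx⟩

theorem IsRanked.isTree_switch (hG : G.IsRanked rank) (hB : G.IsTree B) (e : E) :
    G.IsTree (G.switch B e) := by
  have hu : ∀ v, v ≠ G.target → ∃! e', e' ∈ G.switch B e ∧ G.src e' = v := by
    intro v hv
    by_cases hve : v = G.src e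
    · refine ⟨e, ⟨mem_switch.2 (Or.inl rfl), hve.symm⟩, ?_⟩
      rintro e' ⟨h, hs⟩
      rcases mem_switch.1 h with rfl | h
      · rfl
      · exact absurd (hs.trans hve) h.2
    · obtain ⟨e₁, ⟨h₁, rfl⟩, h₂⟩ := hB.1 v hv
      refine ⟨e₁, ⟨mem_switch.2 (Or.inr ⟨h₁, hve⟩), rfl⟩, ?_⟩
      rintro e' ⟨h, hs⟩
      rcases mem_switch.1 h with rfl | h
      · exact absurd hs.symm hve
      · exact h₂ e' ⟨h.1, hs⟩
  exact ⟨hu, fun e' _ => hG.src_ne e',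
    hG.exists_pathCost fun v hv => (hu v hv).exists⟩

theorem IsRanked.dist_switch_le (hG : G.IsRanked rank) (hB : G.IsTree B) {e : E}
    (he : G.Improving B e) (v : V) : G.dist (G.switch B e) v ≤ G.dist B v := by
  have hS := hG.isTree_switch hB e
  induction hn : rank v using Nat.strong_induction_on generalizing v with
  | _ m ih =>
    by_cases hv : v = G.target
    · subst hv
      rw [hS.dist_target, hB.dist_target]
    · obtain ⟨e', he', rfl⟩ := (hS.1 v hv).exists
      have h1 := ih _ (hn ▸ hG.lt e') (G.dst e') rfl
      rw [hS.dist_src he']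
      rcases mem_switch.1 he' with rfl | h
      · have := hB.improving_iff.1 he
        linarith
      · rw [hB.dist_src h.1]
        linarith

theorem IsRanked.dist_switch_lt (hG : G.IsRanked rank) (hB : G.IsTree B) {e : E}
    (he : G.Improving B e) : G.dist (G.switch B e) (G.src e) < G.dist B (G.src e) := by
  have hS := hG.isTree_switch hB e
  have h1 := hG.dist_switch_le hB he (G.dst e)
  have h2 := hB.improving_iff.1 he
  rw [hS.dist_src (mem_switch.2 (Or.inl rfl))]
  linarith

/-- The tree `B` is optimal for the instance with edge set `F`: no edge of `F` is an improving
switch. -/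
structure IsOptimal (G : PathInstance V E) (F B : Finset E) : Prop where
  isTree : G.IsTree B
  subset : B ⊆ F
  not_improving : ∀ e ∈ F, ¬ G.Improving B e

theorem IsOptimal.dist_src_le (h : G.IsOptimal F B) {e : E} (he : e ∈ F) :
    G.dist B (G.src e) ≤ G.cost e + G.dist B (G.dst e) := by
  have := h.not_improving e he
  rwa [h.isTree.improving_iff, not_lt] at this

/-- What is known of a tree `B'` returned by `Random-Facet(F, B)`, whatever the random choices:
it is optimal for `F`, and its path costs do not exceed those of `B`. -/
structure IsOutcome (G : PathInstance V E) (F B B' : Finset E) : Prop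
    extends G.IsOptimal F B' where
  dist_le : ∀ v, G.dist B' v ≤ G.dist B v

/-- All path costs in `B'` are at most those in `B`, and one of them is smaller. -/
def Better (G : PathInstance V E) (B' B : Finset E) : Prop :=
  (∀ v, G.dist B' v ≤ G.dist B v) ∧ ∃ v, G.dist B' v < G.dist B v

theorem better_wellFounded [Finite E] : WellFounded G.Better := by
  have : IsTrans (Finset E) G.Better :=
    ⟨fun _ _ _ h h' => ⟨fun v => (h.1 v).trans (h'.1 v),
      h.2.imp fun v hv => hv.trans_le (h'.1 v)⟩⟩
  have : Std.Irrefl G.Better := ⟨fun _ h => h.2.elim fun _ => lt_irrefl _⟩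
  exact Finite.wellFounded_of_trans_of_irrefl _

theorem IsRanked.better_switch (hG : G.IsRanked rank) {B' : Finset E} {e : E}
    (hB' : G.IsTree B') (hle : ∀ v, G.dist B' v ≤ G.dist B v) (he : G.Improving B' e) :
    G.Better (G.switch B' e) B :=
  ⟨fun v => (hG.dist_switch_le hB' he v).trans (hle v),
    G.src e, (hG.dist_switch_lt hB' he).trans_le (hle _)⟩

variable [DecidableEq E]

theorem subset_erase_of_mem_sdiff {e : E} (hF : B ⊆ F) (he : e ∈ F \ B) : B ⊆ F.erase e :=
  Finset.subset_erase.2 ⟨hF, (Finset.mem_sdiff.1 he).2⟩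

theorem IsOutcome.switch_subset {e : E} {B' : Finset E} (h : G.IsOutcome (F.erase e) B B')
    (he : e ∈ F \ B) : G.switch B' e ⊆ F :=
  PathInstance.switch_subset (h.subset.trans (Finset.erase_subset _ _)) (Finset.mem_sdiff.1 he).1

/-- The property `P` holds for every call that `Random-Facet(F, B)` can make, whichever edge `e`
is picked and whichever tree `B'` the first call returns: this is the induction hypothesis in
proofs by induction along the recursive calls. -/
structure ForallCalls (G : PathInstance V E) (P : Finset E → Finset E → Prop)
    (F B : Finset E) : Prop where
  isTree : G.IsTree B
  subset : B ⊆ F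
  first : ∀ e ∈ F \ B, P (F.erase e) B
  second : ∀ e ∈ F \ B, ∀ B', G.IsOutcome (F.erase e) B B' → G.Improving B' e →
    P F (G.switch B' e)

/-- The second call of Random-Facet keeps `F`, so the induction is on the size of `F` and then on
the well-founded relation `Better` on trees. -/
theorem IsRanked.forallCalls_induction [Finite E] (hG : G.IsRanked rank)
    {P : Finset E → Finset E → Prop} (step : ∀ F B, G.ForallCalls P F B → P F B)
    (hB : G.IsTree B) (hF : B ⊆ F) : P F B := by
  induction hn : F.card using Nat.strong_induction_on generalizing F B with
  | _ m ih =>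
    induction B using (better_wellFounded (G := G)).induction with
    | _ B ihB =>
      refine step F B ⟨hB, hF, fun e he => ?_, fun e he B' hB' hi => ?_⟩
      · exact ih _ (hn ▸ Finset.card_erase_lt_of_mem (Finset.mem_sdiff.1 he).1) hB
          (subset_erase_of_mem_sdiff hF he) rfl
      · exact ihB _ (hG.better_switch hB'.isTree hB'.dist_le hi) (hG.isTree_switch hB'.isTree e)
          (hB'.switch_subset he)

end PathInstance

namespace CompTree

variable {V E : Type} {G : PathInstance V E} {rank : V → ℕ} [DecidableEq E]
  {F B : Finset E} {T : CompTree E}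

theorem IsRun.isOutcome_result (hG : G.IsRanked rank) (hB : G.IsTree B) (hF : B ⊆ F)
    (hT : IsRun G F B T) : G.IsOutcome F B (result G B T) := by
  induction T generalizing F B with
  | leaf =>
    have hFB : F = B := hT
    subst hFB
    refine ⟨⟨hB, hF, fun e he => ?_⟩, fun v => le_rfl⟩
    change ¬ G.Improving F e
    rw [hB.improving_iff, hB.dist_src he]
    exact lt_irrefl _
  | left e l ihl =>
    obtain ⟨he, hl, hi⟩ := hT
    have hopt := ihl hB (PathInstance.subset_erase_of_mem_sdiff hF he) hl
    refine ⟨⟨hopt.isTree, hopt.subset.trans (Finset.erase_subset _ _), fun e' he' => ?_⟩,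
      hopt.dist_le⟩
    by_cases hee : e' = e
    · exact hee ▸ hi
    · exact hopt.not_improving e' (Finset.mem_erase.2 ⟨hee, he'⟩)
  | both e l r ihl ihr =>
    obtain ⟨he, hl, hi, hr⟩ := hT
    have hopt := ihl hB (PathInstance.subset_erase_of_mem_sdiff hF he) hl
    have hopt' := ihr (hG.isTree_switch hopt.isTree e) (hopt.switch_subset he) hr
    exact ⟨hopt'.toIsOptimal, fun v =>
      (hopt'.dist_le v).trans ((hG.better_switch hopt.isTree hopt.dist_le hi).1 v)⟩

/-- The constructors of `CompTree` as a sum type, to split sums over computation trees. -/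
def equivSum (E : Type) :
    CompTree E ≃ Unit ⊕ (E × CompTree E) ⊕ (E × CompTree E × CompTree E) where
  toFun
    | leaf => Sum.inl ()
    | left e l => Sum.inr (Sum.inl (e, l))
    | both e l r => Sum.inr (Sum.inr (e, l, r))
  invFun
    | Sum.inl _ => leaf
    | Sum.inr (Sum.inl (e, l)) => left e l
    | Sum.inr (Sum.inr (e, l, r)) => both e l r
  left_inv T := by cases T <;> rfl
  right_inv x := by rcases x with _ | _ | _ <;> rfl

theorem tsum_eq {E : Type} (f : CompTree E → ℝ≥0∞) :
    ∑' T, f T = f leaf + (∑' e, ∑' l, f (left e l) + ∑' e, ∑' l, ∑' r, f (both e l r)) := by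
  rw [← (equivSum E).symm.tsum_eq f, ENNReal.summable.tsum_sum ENNReal.summable,
    ENNReal.summable.tsum_sum ENNReal.summable, tsum_fintype, ENNReal.tsum_prod',
    ENNReal.tsum_prod']
  simp only [ENNReal.tsum_prod', Finset.univ_unique, Finset.sum_singleton]
  rfl

open Classical in
/-- The probability of a computation tree, extended by `0` to the trees that the call cannot
generate. -/
noncomputable def runProb (G : PathInstance V E) (F B : Finset E) (T : CompTree E) : ℝ≥0∞ :=
  if IsRun G F B T then prob G F B T else 0

theorem expectedSwitches_eq_tsum_runProb (F B : Finset E) :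
    expectedSwitches G F B = ∑' T, runProb G F B T * (T.numSwitches : ℝ≥0∞) := by
  classical
  refine (tsum_subtype {T : CompTree E | IsRun G F B T}
    fun T => prob G F B T * (T.numSwitches : ℝ≥0∞)).trans (tsum_congr fun T => ?_)
  simp only [Set.indicator_apply, Set.mem_ofPred_eq, runProb, ite_mul, zero_mul]

theorem runProb_leaf (h : F ≠ B) : runProb G F B leaf = 0 :=
  if_neg h

open Classical in
theorem runProb_left (e : E) (l : CompTree E) :
    runProb G F B (left e l) = if e ∈ F \ B then ((F \ B).card : ℝ≥0∞)⁻¹ *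
      (runProb G (F.erase e) B l * if G.Improving (result G B l) e then 0 else 1) else 0 := by
  by_cases h1 : e ∈ F \ B <;> by_cases h2 : IsRun G (F.erase e) B l <;>
    by_cases h3 : G.Improving (result G B l) e <;> simp [runProb, IsRun, prob, *]

open Classical in
theorem runProb_both (e : E) (l r : CompTree E) :
    runProb G F B (both e l r) = if e ∈ F \ B then ((F \ B).card : ℝ≥0∞)⁻¹ *
      (runProb G (F.erase e) B l * if G.Improving (result G B l) e then
        runProb G F (G.switch (result G B l) e) r else 0) else 0 := by
  by_cases h1 : e ∈ F \ B <;> by_cases h2 : IsRun G (F.erase e) B l <;>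
    by_cases h3 : G.Improving (result G B l) e <;>
    by_cases h4 : IsRun G F (G.switch (result G B l) e) r <;>
    simp [runProb, IsRun, prob, *, mul_assoc]

open Classical in
theorem tsum_runProb_mul (h : F ≠ B) (f : CompTree E → ℝ≥0∞) :
    ∑' T, runProb G F B T * f T = ((F \ B).card : ℝ≥0∞)⁻¹ * ∑ e ∈ F \ B, ∑' l,
      runProb G (F.erase e) B l * if G.Improving (result G B l) e then
        ∑' r, runProb G F (G.switch (result G B l) e) r * f (both e l r) else f (left e l) := by
  rw [tsum_eq, runProb_leaf h, zero_mul, zero_add, ← ENNReal.tsum_add, Finset.mul_sum,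
    tsum_eq_sum (s := F \ B)]
  · refine Finset.sum_congr rfl fun e he => ?_
    rw [← ENNReal.tsum_add, ← ENNReal.tsum_mul_left]
    refine tsum_congr fun l => ?_
    simp only [runProb_left, runProb_both, if_pos he]
    by_cases hi : G.Improving (result G B l) e
    · simp only [if_pos hi, mul_zero, zero_mul, zero_add, mul_assoc, ENNReal.tsum_mul_left]
    · simp [if_neg hi, mul_assoc]
  · intro e he
    simp only [runProb_left, runProb_both, if_neg he]
    simp

theorem runProb_mul_congr {x y : ℝ≥0∞} (h : IsRun G F B T → x = y) :
    runProb G F B T * x = runProb G F B T * y := by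
  by_cases hT : IsRun G F B T
  · rw [h hT]
  · simp only [runProb, if_neg hT, zero_mul]

theorem runProb_mul_le_mul {x y : ℝ≥0∞} (h : IsRun G F B T → x ≤ y) :
    runProb G F B T * x ≤ runProb G F B T * y := by
  by_cases hT : IsRun G F B T
  · gcongr
    exact h hT
  · simp only [runProb, if_neg hT, zero_mul, le_refl]

theorem card_sdiff_pos_of_ne (hF : B ⊆ F) (h : F ≠ B) : 0 < (F \ B).card :=
  Finset.card_pos.2 (Finset.sdiff_nonempty.2 fun hFB => h (hFB.antisymm hF))

/-- `Random-Facet` terminates with probability one. -/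
theorem tsum_runProb [Finite E] (hG : G.IsRanked rank) (hB : G.IsTree B) (hF : B ⊆ F) :
    ∑' T, runProb G F B T = 1 := by
  classical
  refine hG.forallCalls_induction (P := fun F B => ∑' T, runProb G F B T = 1) ?_ hB hF
  intro F B hcalls
  by_cases h : F = B
  · subst h
    rw [tsum_eq]
    simp only [runProb_left, runProb_both, Finset.sdiff_self, Finset.notMem_empty, if_false]
    simp [runProb, IsRun, prob]
  · have hsum : ∀ e ∈ F \ B, (∑' l, runProb G (F.erase e) B l *
        if G.Improving (result G B l) e then
          ∑' r, runProb G F (G.switch (result G B l) e) r else 1) = 1 := by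
      intro e he
      refine (tsum_congr fun l => ?_).trans (hcalls.first e he)
      refine (runProb_mul_congr fun hl => ?_).trans (mul_one _)
      split_ifs with hi
      · exact hcalls.second e he _ (hl.isOutcome_result hG hcalls.isTree
          (PathInstance.subset_erase_of_mem_sdiff hcalls.subset he)) hi
      · rfl
    have hc := card_sdiff_pos_of_ne hcalls.subset h
    have hstep := tsum_runProb_mul (G := G) h fun _ => 1
    simp only [mul_one] at hstep
    rw [hstep, Finset.sum_congr rfl hsum, Finset.sum_const, nsmul_one]
    exact ENNReal.inv_mul_cancel (by exact_mod_cast hc.ne') (ENNReal.natCast_ne_top _)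

theorem tsum_runProb_mul_add_numSwitches [Finite E] (hG : G.IsRanked rank) (hB : G.IsTree B)
    (hF : B ⊆ F) (c : ℝ≥0∞) :
    ∑' T, runProb G F B T * (c + (T.numSwitches : ℝ≥0∞)) = c + expectedSwitches G F B := by
  simp only [mul_add]
  rw [ENNReal.tsum_add, ENNReal.tsum_mul_right, tsum_runProb hG hB hF, one_mul,
    expectedSwitches_eq_tsum_runProb]

open Classical in
/-- One plus the expected number of improving switches performed by `Random-Facet(F, B)`, given
that the call picks the edge `e`. -/
noncomputable def pickValue (G : PathInstance V E) (F B : Finset E) (e : E) : ℝ≥0∞ :=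
  ∑' l, runProb G (F.erase e) B l * if G.Improving (result G B l) e then
    1 + (l.numSwitches : ℝ≥0∞) + (1 + expectedSwitches G F (G.switch (result G B l) e))
  else 1 + (l.numSwitches : ℝ≥0∞)

theorem one_add_expectedSwitches_eq [Finite E] (hG : G.IsRanked rank) (hB : G.IsTree B)
    (hF : B ⊆ F) (h : F ≠ B) :
    1 + expectedSwitches G F B =
      ((F \ B).card : ℝ≥0∞)⁻¹ * ∑ e ∈ F \ B, pickValue G F B e := by
  classical
  rw [← tsum_runProb_mul_add_numSwitches hG hB hF, tsum_runProb_mul h]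
  congr 1
  refine Finset.sum_congr rfl fun e he => tsum_congr fun l => runProb_mul_congr fun hl => ?_
  have hopt := hl.isOutcome_result hG hB (PathInstance.subset_erase_of_mem_sdiff hF he)
  congr 1
  rw [← add_assoc, ← tsum_runProb_mul_add_numSwitches hG (hG.isTree_switch hopt.isTree e)
    (hopt.switch_subset he)]
  refine tsum_congr fun r => ?_
  rw [numSwitches]
  push_cast
  ring

theorem le_pickValue_of_first [Finite E] (hG : G.IsRanked rank) (hB : G.IsTree B)
    (hF : B ⊆ F) {e : E} (he : e ∈ F \ B) :
    1 + expectedSwitches G (F.erase e) B ≤ pickValue G F B e := by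
  rw [← tsum_runProb_mul_add_numSwitches hG hB (PathInstance.subset_erase_of_mem_sdiff hF he)]
  refine ENNReal.tsum_le_tsum fun l => ?_
  gcongr
  split_ifs
  · exact le_self_add
  · exact le_rfl

theorem le_pickValue_of_both [Finite E] (hG : G.IsRanked rank) (hB : G.IsTree B)
    (hF : B ⊆ F) {e : E} (he : e ∈ F \ B) {b : ℝ≥0∞}
    (hb : ∀ B', G.IsOutcome (F.erase e) B B' →
      G.Improving B' e ∧ b ≤ 1 + expectedSwitches G F (G.switch B' e)) :
    1 + expectedSwitches G (F.erase e) B + b ≤ pickValue G F B e := by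
  have hFe := PathInstance.subset_erase_of_mem_sdiff hF he
  have hsum : ∑' l, runProb G (F.erase e) B l * (1 + (l.numSwitches : ℝ≥0∞) + b) =
      1 + expectedSwitches G (F.erase e) B + b := by
    rw [add_right_comm, ← tsum_runProb_mul_add_numSwitches hG hB hFe]
    simp only [add_right_comm _ _ b]
  rw [← hsum]
  refine ENNReal.tsum_le_tsum fun l => runProb_mul_le_mul fun hl => ?_
  obtain ⟨hi, hle⟩ := hb _ (hl.isOutcome_result hG hB hFe)
  rw [if_pos hi]
  gcongr

theorem ofReal_le_one_add_expectedSwitches [Finite E] (hG : G.IsRanked rank)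
    (hB : G.IsTree B) (hF : B ⊆ F) (h : F ≠ B) {x : ℝ} {φ : E → ℝ}
    (hx : ((F \ B).card : ℝ) * x ≤ ∑ e ∈ F \ B, φ e)
    (hφ : ∀ e ∈ F \ B, ENNReal.ofReal (φ e) ≤ pickValue G F B e) :
    ENNReal.ofReal x ≤ 1 + expectedSwitches G F B := by
  have hc : (0 : ℝ) < (F \ B).card := by exact_mod_cast card_sdiff_pos_of_ne hF h
  calc ENNReal.ofReal x
      ≤ ENNReal.ofReal (((F \ B).card : ℝ)⁻¹ * ∑ e ∈ F \ B, φ e) :=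
        ENNReal.ofReal_le_ofReal ((le_inv_mul_iff₀ hc).2 hx)
    _ = ((F \ B).card : ℝ≥0∞)⁻¹ * ENNReal.ofReal (∑ e ∈ F \ B, φ e) := by
        rw [ENNReal.ofReal_mul (by positivity), ENNReal.ofReal_inv_of_pos hc,
          ENNReal.ofReal_natCast]
    _ ≤ ((F \ B).card : ℝ≥0∞)⁻¹ * ∑ e ∈ F \ B, ENNReal.ofReal (φ e) := by
        gcongr
        exact Finset.le_sum_of_subadditive ENNReal.ofReal ENNReal.ofReal_zero.le
          (fun _ _ => ENNReal.ofReal_add_le) _ _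
    _ ≤ ((F \ B).card : ℝ≥0∞)⁻¹ * ∑ e ∈ F \ B, pickValue G F B e := by
        gcongr with e he
        exact hφ e he
    _ = 1 + expectedSwitches G F B := (one_add_expectedSwitches_eq hG hB hF h).symm

end CompTree

/-- A path of `L` edges whose `j`-th vertex also has an exit, seen through the values of an optimal
tree: `y j` is the value of the `j`-th vertex, `z j` the value it gets from its exit, `avail j`
says that the `j`-th path edge is available, and `used j` that the tree contains it. The `a`-paths
and the `b`-paths of `G_{n,r,s,t}` are of this kind. -/
structure IsExitPath (L : ℕ) (y z : ℕ → ℝ) (avail used : Fin L → Prop) : Prop where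
  strictMono_exit : StrictMono z
  avail_of_used : ∀ j, used j → avail j
  eq_next : ∀ j, used j → y j = y (j + 1)
  eq_exit_of_not_used : ∀ j, ¬ used j → y j = z j
  le_next : ∀ j, avail j → y j ≤ y (j + 1)
  le_exit : ∀ j : Fin L, y j ≤ z j

namespace IsExitPath

variable {L : ℕ} {y z : ℕ → ℝ} {avail used : Fin L → Prop}

theorem eq_end (h : IsExitPath L y z avail used) (hz : y L < z 0) {j : ℕ} (hj : j ≤ L)
    (ha : ∀ j' : Fin L, j ≤ j' → avail j') : y j = y L := by
  induction hj using Nat.decreasingInduction with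
  | self => rfl
  | of_succ j hj ih =>
    have hnext := ih fun j' hj' => ha j' (Nat.le_of_succ_le hj')
    by_cases hu : used ⟨j, hj⟩
    · exact (h.eq_next _ hu).trans hnext
    · have hle : y j ≤ y (j + 1) := h.le_next _ (ha ⟨j, hj⟩ le_rfl)
      have hexit : y j = z j := h.eq_exit_of_not_used _ hu
      linarith [h.strictMono_exit.monotone (Nat.zero_le j)]

theorem used_of_avail (h : IsExitPath L y z avail used) (hz : y L < z 0) (ha : ∀ j, avail j)
    (j : Fin L) : used j := by
  by_contra hu
  have hend := h.eq_end hz j.2.le fun j' _ => ha j'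
  linarith [h.eq_exit_of_not_used _ hu, h.strictMono_exit.monotone (Nat.zero_le j)]

theorem exit_le (h : IsExitPath L y z avail used) {j : ℕ} (hj : j ≤ L)
    (hb : (∃ j' : Fin L, j ≤ j' ∧ ¬ avail j') ∨ z L ≤ y L) : z j ≤ y j := by
  induction hj using Nat.decreasingInduction with
  | self => exact hb.resolve_left fun ⟨j', hj', _⟩ => j'.2.not_ge hj'
  | of_succ j hj ih =>
    by_cases hu : used ⟨j, hj⟩
    · have hnext : z (j + 1) ≤ y (j + 1) := by
        refine ih (hb.imp_left ?_)
        rintro ⟨j', hj', ha⟩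
        refine ⟨j', lt_of_le_of_ne hj' ?_, ha⟩
        rintro rfl
        exact ha (h.avail_of_used _ hu)
      have heq : y j = y (j + 1) := h.eq_next _ hu
      exact heq ▸ (h.strictMono_exit (Nat.lt_succ_self j)).le.trans hnext
    · exact (h.eq_exit_of_not_used _ hu).ge

theorem eq_exit (h : IsExitPath L y z avail used) {j : Fin L}
    (hb : (∃ j', j ≤ j' ∧ ¬ avail j') ∨ z L ≤ y L) : y j = z j :=
  (h.le_exit j).antisymm (h.exit_le j.2.le hb)

theorem not_used (h : IsExitPath L y z avail used) {j : Fin L}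
    (hb : (∃ j', j ≤ j' ∧ ¬ avail j') ∨ z L ≤ y L) : ¬ used j := by
  intro hu
  have hnext : z (j + 1) ≤ y (j + 1) := by
    refine h.exit_le j.2 (hb.imp_left ?_)
    rintro ⟨j', hj', ha⟩
    refine ⟨j', lt_of_le_of_ne hj' ?_, ha⟩
    rintro rfl
    exact ha (h.avail_of_used _ hu)
  linarith [h.eq_next _ hu, h.eq_exit hb, h.strictMono_exit (Nat.lt_succ_self j)]

end IsExitPath

namespace CounterGraph

/-- The multi-edges of `G_{n,r,s,t}`, each of which has `t` parallel copies. -/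
inductive MultiEdge (n r s : ℕ) : Type
  | a0 (i : Fin n) (j : Fin r) (k : Fin s)
  | b0 (i : Fin n) (j : Fin (r * s))
  | u1 (i : Fin n)
  | u0 (i : Fin n)
  | wj (i : Fin n) (j : Fin r)
  | w0 (i : Fin n)
  deriving Fintype

variable {n r s t : ℕ}

/-- The `l`-th copy of a multi-edge. -/
def MultiEdge.copy : MultiEdge n r s → Fin t → CEdge n r s t
  | a0 i j k, l => .a0 i j k l
  | b0 i j, l => .b0 i j l
  | u1 i, l => .u1 i l
  | u0 i, l => .u0 i l
  | wj i j, l => .wj i j l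
  | w0 i, l => .w0 i l

theorem MultiEdge.copy_injective (m : MultiEdge n r s) :
    Function.Injective (m.copy : Fin t → CEdge n r s t) := by
  intro l l' h
  cases m <;> simpa [copy] using h

theorem MultiEdge.copy_ne_b1 (m : MultiEdge n r s) (l : Fin t) (i : Fin n) (j : Fin (r * s)) :
    m.copy l ≠ .b1 i j := by
  cases m <;> simp [copy]

theorem MultiEdge.copy_ne_a1 (m : MultiEdge n r s) (l : Fin t) (i : Fin n) (j : Fin r)
    (k : Fin s) : m.copy l ≠ .a1 i j k := by
  cases m <;> simp [copy]

variable {F B : Finset (CEdge n r s t)}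

/-- Some copy of every multi-edge belongs to `F`. -/
def HasCopies (F : Finset (CEdge n r s t)) : Prop :=
  ∀ m : MultiEdge n r s, ∃ l, m.copy l ∈ F

theorem HasCopies.erase_b1 (hc : HasCopies F) (i : Fin n) (j : Fin (r * s)) :
    HasCopies (F.erase (.b1 i j)) :=
  fun m => (hc m).imp fun l hl => Finset.mem_erase.2 ⟨m.copy_ne_b1 l i j, hl⟩

theorem HasCopies.erase_a1 (hc : HasCopies F) (i : Fin n) (j : Fin r) (k : Fin s) :
    HasCopies (F.erase (.a1 i j k)) :=
  fun m => (hc m).imp fun l hl => Finset.mem_erase.2 ⟨m.copy_ne_a1 l i j k, hl⟩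

/-- The edges of the `b`-path of level `i` belong to `S`. -/
def BPath (S : Finset (CEdge n r s t)) (i : Fin n) : Prop :=
  ∀ j, CEdge.b1 i j ∈ S

/-- The edges of the `j`-th `a`-path of level `i` belong to `S`. -/
def APath (S : Finset (CEdge n r s t)) (i : Fin n) (j : Fin r) : Prop :=
  ∀ k, CEdge.a1 i j k ∈ S

theorem BPath.mono {S S' : Finset (CEdge n r s t)} {i : Fin n} (h : BPath S i) (hS : S ⊆ S') :
    BPath S' i :=
  fun j => hS (h j)

theorem APath.mono {S S' : Finset (CEdge n r s t)} {i : Fin n} {j : Fin r} (h : APath S i j)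
    (hS : S ⊆ S') : APath S' i j :=
  fun k => hS (h k)

/-- The vertex `b_{i,j+1}`, with the convention `b_{i,rs+1} = w_{i+1}`. -/
def bVertex (i : Fin n) (j : ℕ) : CVertex n r s :=
  if h : j < r * s then .b i ⟨j, h⟩ else .wNext i

/-- The vertex `a_{i,j,k+1}`, with the convention `a_{i,j,s+1} = b_{i,1}`. -/
def aVertex (i : Fin n) (j : Fin r) (k : ℕ) : CVertex n r s :=
  if h : k < s then .a i j ⟨k, h⟩ else .bFirst i

theorem bVertex_val (i : Fin n) (j : Fin (r * s)) : bVertex i j = .b i j :=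
  dif_pos j.2

theorem aVertex_val (i : Fin n) (j : Fin r) (k : Fin s) : aVertex i j k = .a i j k :=
  dif_pos k.2

theorem bVertex_end (i : Fin n) : (bVertex i (r * s) : CVertex n r s) = .wNext i :=
  dif_neg (lt_irrefl _)

theorem aVertex_end (i : Fin n) (j : Fin r) : (aVertex i j s : CVertex n r s) = .bFirst i :=
  dif_neg (lt_irrefl _)

theorem bFirst_eq_bVertex_zero (h : 0 < r * s) (i : Fin n) :
    (.bFirst i : CVertex n r s) = bVertex i 0 := by
  rw [bVertex, CVertex.bFirst, dif_pos h, dif_pos h]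

theorem aFirst_eq_aVertex_zero (h : 0 < s) (i : Fin n) (j : Fin r) :
    (.aFirst i j : CVertex n r s) = aVertex i j 0 := by
  rw [aVertex, CVertex.aFirst, dif_pos h, dif_pos h]

/-- The number of edges on a longest path to the target, up to a slack at each level. -/
def rank : CVertex n r s → ℕ
  | .target => 0
  | .u i => (n - i) * (r * s + s + 2)
  | .w i => (n - i) * (r * s + s + 2)
  | .a i _ k => (n - 1 - i) * (r * s + s + 2) + r * s + (s - k) + 1
  | .b i j => (n - 1 - i) * (r * s + s + 2) + (r * s - j)

theorem rank_uNext (i : Fin n) :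
    rank (.uNext i : CVertex n r s) = (n - 1 - i) * (r * s + s + 2) := by
  unfold CVertex.uNext
  split_ifs with h
  · rw [rank, Nat.sub_sub, Nat.add_comm 1]
  · rw [rank, Nat.sub_sub, Nat.add_comm 1, Nat.sub_eq_zero_of_le (not_lt.1 h), zero_mul]

theorem rank_wNext (i : Fin n) :
    rank (.wNext i : CVertex n r s) = (n - 1 - i) * (r * s + s + 2) := by
  unfold CVertex.wNext
  split_ifs with h
  · rw [rank, Nat.sub_sub, Nat.add_comm 1]
  · rw [rank, Nat.sub_sub, Nat.add_comm 1, Nat.sub_eq_zero_of_le (not_lt.1 h), zero_mul]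

theorem rank_bVertex (i : Fin n) (j : ℕ) :
    rank (bVertex i j : CVertex n r s) = (n - 1 - i) * (r * s + s + 2) + (r * s - j) := by
  unfold bVertex
  split_ifs with h
  · rfl
  · rw [rank_wNext, Nat.sub_eq_zero_of_le (not_lt.1 h), add_zero]

theorem rank_bFirst_le (i : Fin n) :
    rank (.bFirst i : CVertex n r s) ≤ (n - 1 - i) * (r * s + s + 2) + r * s := by
  unfold CVertex.bFirst
  split_ifs <;> simp [rank]

theorem rank_aVertex_le (i : Fin n) (j : Fin r) (k : ℕ) :
    rank (aVertex i j k : CVertex n r s) ≤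
      (n - 1 - i) * (r * s + s + 2) + r * s + (s - k) + 1 := by
  unfold aVertex
  split_ifs with h
  · exact le_rfl
  · have := rank_bFirst_le (r := r) (s := s) i
    omega

theorem rank_aFirst_le (i : Fin n) (j : Fin r) :
    rank (.aFirst i j : CVertex n r s) ≤
      (n - 1 - i) * (r * s + s + 2) + r * s + s + 1 := by
  unfold CVertex.aFirst
  split_ifs <;> simp [rank]

theorem isRanked : (counterGraph n r s t).IsRanked rank where
  src_ne e := by cases e <;> simp [counterGraph, CEdge.src]
  lt e := by
    have hlevel : ∀ i : Fin n, (n - i.val) * (r * s + s + 2) =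
        (n - 1 - i) * (r * s + s + 2) + (r * s + s + 2) := by
      intro i
      have hi : n - i.val = n - 1 - i.val + 1 := by omega
      rw [hi, Nat.add_mul, one_mul]
    change rank e.dst < rank e.src
    cases e with
    | a1 i j k =>
      refine (rank_aVertex_le i j (k + 1)).trans_lt ?_
      simp only [CEdge.src, rank]
      omega
    | b1 i j =>
      refine (rank_bVertex i (j + 1)).trans_lt ?_
      simp only [CEdge.src, rank]
      omega
    | u1 i =>
      refine (rank_bFirst_le i).trans_lt ?_
      simp only [CEdge.src, rank, hlevel]
      omega
    | wj i j =>
      refine (rank_aFirst_le i j).trans_lt ?_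
      simp only [CEdge.src, rank, hlevel]
      omega
    | a0 i | b0 i | u0 i =>
      refine (rank_uNext i).trans_lt ?_
      simp only [CEdge.src, rank, hlevel]
      omega
    | w0 i =>
      refine (rank_wNext i).trans_lt ?_
      simp only [CEdge.src, rank, hlevel]
      omega

/-- The value `y_B(v)` of a vertex in a tree `B`. -/
noncomputable abbrev val (B : Finset (CEdge n r s t)) (v : CVertex n r s) : ℝ :=
  (counterGraph n r s t).dist B v

/-- The cost of the zero-edges that leave `u_{i+1}` and `w_{i+1}`. -/
noncomputable def levelCost (i : Fin n) : ℝ := 2 ^ (2 * (i.val + 1))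

theorem one_le_levelCost (i : Fin n) : 1 ≤ levelCost i :=
  one_le_pow₀ (by norm_num)

theorem levelCost_succ {i : ℕ} (h : i + 1 < n) :
    levelCost ⟨i + 1, h⟩ = 4 * levelCost ⟨i, (Nat.lt_succ_self i).trans h⟩ := by
  rw [levelCost, levelCost]
  ring

/-- The value that `b_{i,j+1}` gets from its zero-edges. -/
noncomputable def bExit (B : Finset (CEdge n r s t)) (i : Fin n) (j : ℕ) : ℝ :=
  2 * levelCost i + 1 + j * (1 / ((r : ℝ) * s)) + val B (.uNext i)

/-- The value that `a_{i,j,k+1}` gets from its zero-edges, which does not depend on `j`. -/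
noncomputable def aExit (B : Finset (CEdge n r s t)) (i : Fin n) (k : ℕ) : ℝ :=
  2 * levelCost i + k * (1 / ((r : ℝ) * s)) + val B (.uNext i)

theorem bExit_zero (B : Finset (CEdge n r s t)) (i : Fin n) :
    bExit B i 0 = 2 * levelCost i + 1 + val B (.uNext i) := by
  simp [bExit]

theorem aExit_zero (B : Finset (CEdge n r s t)) (i : Fin n) :
    aExit B i 0 = 2 * levelCost i + val B (.uNext i) := by
  simp [aExit]

theorem strictMono_mul_eps (h : 0 < r * s) :
    StrictMono fun j : ℕ => (j : ℝ) * (1 / ((r : ℝ) * s)) := by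
  have hpos : (0 : ℝ) < (r : ℝ) * s := by exact_mod_cast h
  exact fun j j' hj => mul_lt_mul_of_pos_right (Nat.cast_lt.2 hj) (by positivity)

theorem strictMono_bExit (h : 0 < r * s) (B : Finset (CEdge n r s t)) (i : Fin n) :
    StrictMono (bExit B i) :=
  fun _ _ hj => add_lt_add_left (add_lt_add_right (strictMono_mul_eps h hj) _) _

theorem strictMono_aExit (h : 0 < r * s) (B : Finset (CEdge n r s t)) (i : Fin n) :
    StrictMono (aExit B i) :=
  fun _ _ hk => add_lt_add_left (add_lt_add_right (strictMono_mul_eps h hk) _) _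

theorem bExit_end (h : 0 < r * s) (B : Finset (CEdge n r s t)) (i : Fin n) :
    bExit B i (r * s) = 2 * levelCost i + 2 + val B (.uNext i) := by
  have hne : (r : ℝ) * s ≠ 0 := by exact_mod_cast h.ne'
  rw [bExit, Nat.cast_mul, mul_one_div_cancel hne]
  ring

theorem aExit_end_le (h : 0 < r * s) (B : Finset (CEdge n r s t)) (i : Fin n) :
    aExit B i s ≤ 2 * levelCost i + 1 + val B (.uNext i) := by
  have hle := (strictMono_aExit h B i).monotone
    (Nat.le_mul_of_pos_left s (Nat.pos_of_mul_pos_right h))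
  have hne : (r : ℝ) * s ≠ 0 := by exact_mod_cast h.ne'
  rwa [aExit, aExit, Nat.cast_mul, mul_one_div_cancel hne] at hle

/-- `B` is an optimal tree for an edge set `F` that contains a copy of every multi-edge, and the
`a`-paths and the `b`-paths are not empty. -/
structure IsFullOptimal (F B : Finset (CEdge n r s t)) : Prop
    extends (counterGraph n r s t).IsOptimal F B where
  hasCopies : HasCopies F
  pos : 0 < r * s

namespace IsFullOptimal

theorem pos_s (h : IsFullOptimal F B) : 0 < s :=
  Nat.pos_of_mul_pos_left h.pos

theorem val_src_le (h : IsFullOptimal F B) {e : CEdge n r s t} (he : e ∈ F) :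
    val B e.src ≤ e.cost + val B e.dst :=
  h.dist_src_le he

theorem val_src_eq (h : IsFullOptimal F B) {e : CEdge n r s t} (he : e ∈ B) :
    val B e.src = e.cost + val B e.dst :=
  h.isTree.dist_src he

theorem exists_mem_src_eq (h : IsFullOptimal F B) {v : CVertex n r s} (hv : v ≠ .target) :
    ∃ e ∈ B, e.src = v :=
  (h.isTree.1 v hv).exists

theorem isExitPath_b (h : IsFullOptimal F B) (i : Fin n) :
    IsExitPath (r * s) (fun j => val B (bVertex i j)) (bExit B i)
      (fun j => CEdge.b1 i j ∈ F) (fun j => CEdge.b1 i j ∈ B) where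
  strictMono_exit := strictMono_bExit h.pos B i
  avail_of_used _ hj := h.subset hj
  eq_next j hj := by
    have hval := h.val_src_eq hj
    rw [CEdge.cost, zero_add] at hval
    rwa [bVertex_val]
  eq_exit_of_not_used j hj := by
    obtain ⟨e, he, hsrc⟩ := h.exists_mem_src_eq (v := .b i j) (by simp)
    have hval := h.val_src_eq he
    cases e <;> simp only [CEdge.src, CVertex.b.injEq, reduceCtorEq] at hsrc <;>
      obtain ⟨rfl, rfl⟩ := hsrc
    · exact absurd he hj
    · rw [bVertex_val]
      refine hval.trans ?_
      rw [CEdge.cost, CEdge.dst, bExit, levelCost]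
      ring
  le_next j hj := by
    have hval := h.val_src_le hj
    rw [CEdge.cost, zero_add] at hval
    rwa [bVertex_val]
  le_exit j := by
    obtain ⟨l, hl⟩ := h.hasCopies (.b0 i j)
    rw [bVertex_val]
    refine (h.val_src_le hl).trans_eq ?_
    rw [MultiEdge.copy, CEdge.cost, CEdge.dst, bExit, levelCost]
    ring

theorem isExitPath_a (h : IsFullOptimal F B) (i : Fin n) (j : Fin r) :
    IsExitPath s (fun k => val B (aVertex i j k)) (aExit B i)
      (fun k => CEdge.a1 i j k ∈ F) (fun k => CEdge.a1 i j k ∈ B) where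
  strictMono_exit := strictMono_aExit h.pos B i
  avail_of_used _ hk := h.subset hk
  eq_next k hk := by
    have hval := h.val_src_eq hk
    rw [CEdge.cost, zero_add] at hval
    rwa [aVertex_val]
  eq_exit_of_not_used k hk := by
    obtain ⟨e, he, hsrc⟩ := h.exists_mem_src_eq (v := .a i j k) (by simp)
    have hval := h.val_src_eq he
    cases e <;> simp only [CEdge.src, CVertex.a.injEq, reduceCtorEq] at hsrc <;>
      obtain ⟨rfl, rfl, rfl⟩ := hsrc
    · exact absurd he hk
    · rw [aVertex_val]
      refine hval.trans ?_
      rw [CEdge.cost, CEdge.dst, aExit, levelCost]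
      ring
  le_next k hk := by
    have hval := h.val_src_le hk
    rw [CEdge.cost, zero_add] at hval
    rwa [aVertex_val]
  le_exit k := by
    obtain ⟨l, hl⟩ := h.hasCopies (.a0 i j k)
    rw [aVertex_val]
    refine (h.val_src_le hl).trans_eq ?_
    rw [MultiEdge.copy, CEdge.cost, CEdge.dst, aExit, levelCost]
    ring

theorem val_u_eq_min (h : IsFullOptimal F B) (i : Fin n) :
    val B (.u i) = min (val B (.bFirst i)) (levelCost i + val B (.uNext i)) := by
  apply le_antisymm
  · obtain ⟨l, hl⟩ := h.hasCopies (.u1 i)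
    obtain ⟨l', hl'⟩ := h.hasCopies (.u0 i)
    refine le_min ((h.val_src_le hl).trans_eq ?_) (h.val_src_le hl')
    rw [MultiEdge.copy, CEdge.cost, CEdge.dst, zero_add]
  · obtain ⟨e, he, hsrc⟩ := h.exists_mem_src_eq (v := .u i) (by simp)
    have hval := h.val_src_eq he
    cases e <;> simp only [CEdge.src, CVertex.u.injEq, reduceCtorEq] at hsrc <;> subst hsrc
    · rw [CEdge.cost, zero_add] at hval
      exact (min_le_left _ _).trans hval.ge
    · exact (min_le_right _ _).trans hval.ge

theorem val_w_le_aFirst (h : IsFullOptimal F B) (i : Fin n) (j : Fin r) :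
    val B (.w i) ≤ val B (.aFirst i j) := by
  obtain ⟨l, hl⟩ := h.hasCopies (.wj i j)
  refine (h.val_src_le hl).trans_eq ?_
  rw [MultiEdge.copy, CEdge.cost, CEdge.dst, zero_add]

theorem val_w_le_wNext (h : IsFullOptimal F B) (i : Fin n) :
    val B (.w i) ≤ levelCost i + val B (.wNext i) := by
  obtain ⟨l, hl⟩ := h.hasCopies (.w0 i)
  exact h.val_src_le hl

theorem val_w_eq_or (h : IsFullOptimal F B) (i : Fin n) :
    (∃ j, val B (.w i) = val B (.aFirst i j)) ∨
      val B (.w i) = levelCost i + val B (.wNext i) := by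
  obtain ⟨e, he, hsrc⟩ := h.exists_mem_src_eq (v := .w i) (by simp)
  have hval := h.val_src_eq he
  cases e <;> simp only [CEdge.src, CVertex.w.injEq, reduceCtorEq] at hsrc <;> subst hsrc
  case wj j l =>
    rw [CEdge.cost, zero_add] at hval
    exact Or.inl ⟨j, hval⟩
  case w0 => exact Or.inr hval

end IsFullOptimal

end CounterGraph

namespace CounterGraph

variable {n r s t : ℕ} {F B B' : Finset (CEdge n r s t)} {i : Fin n} {N : Finset (Fin n)}

namespace IsFullOptimal

theorem val_wNext_lt_bExit_zero (hY : val B (.uNext i) = val B (.wNext i)) :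
    val B (bVertex i (r * s)) < bExit B i 0 := by
  rw [bVertex_end, bExit_zero]
  linarith [one_le_levelCost i]

theorem val_bVertex_of_forall_mem (h : IsFullOptimal F B)
    (hY : val B (.uNext i) = val B (.wNext i)) {j : ℕ} (hj : j ≤ r * s)
    (hb : ∀ j' : Fin (r * s), j ≤ j' → CEdge.b1 i j' ∈ F) :
    val B (bVertex i j) = val B (.wNext i) := by
  rw [← bVertex_end i]
  exact (h.isExitPath_b i).eq_end (val_wNext_lt_bExit_zero hY) hj hb

theorem val_bFirst_of_bPath (h : IsFullOptimal F B) (hY : val B (.uNext i) = val B (.wNext i))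
    (hb : BPath F i) : val B (.bFirst i) = val B (.wNext i) := by
  rw [bFirst_eq_bVertex_zero h.pos]
  exact h.val_bVertex_of_forall_mem hY (Nat.zero_le _) fun j _ => hb j

theorem bPath (h : IsFullOptimal F B) (hY : val B (.uNext i) = val B (.wNext i))
    (hb : BPath F i) : BPath B i :=
  (h.isExitPath_b i).used_of_avail (val_wNext_lt_bExit_zero hY) hb

theorem val_b_of_notMem (h : IsFullOptimal F B) {j : Fin (r * s)} (hj : CEdge.b1 i j ∉ F) :
    val B (.b i j) = bExit B i j := by
  rw [← bVertex_val]
  exact (h.isExitPath_b i).eq_exit (Or.inl ⟨j, le_rfl, hj⟩)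

theorem val_bFirst_of_not_bPath (h : IsFullOptimal F B) (hb : ¬ BPath F i) :
    val B (.bFirst i) = 2 * levelCost i + 1 + val B (.uNext i) := by
  obtain ⟨j, hj⟩ := not_forall.1 hb
  rw [bFirst_eq_bVertex_zero h.pos, ← bExit_zero]
  exact (h.isExitPath_b i).eq_exit (j := ⟨0, h.pos⟩) (Or.inl ⟨j, Nat.zero_le _, hj⟩)

theorem val_aVertex_end_lt_aExit_zero (h : IsFullOptimal F B)
    (hY : val B (.uNext i) = val B (.wNext i)) (hb : BPath F i) (j : Fin r) :
    val B (aVertex i j s) < aExit B i 0 := by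
  rw [aVertex_end, h.val_bFirst_of_bPath hY hb, aExit_zero]
  linarith [one_le_levelCost i]

theorem val_aVertex_of_forall_mem (h : IsFullOptimal F B)
    (hY : val B (.uNext i) = val B (.wNext i)) (hb : BPath F i) {j : Fin r} {k : ℕ}
    (hk : k ≤ s) (ha : ∀ k' : Fin s, k ≤ k' → CEdge.a1 i j k' ∈ F) :
    val B (aVertex i j k) = val B (.wNext i) := by
  rw [← h.val_bFirst_of_bPath hY hb, ← aVertex_end i j]
  exact (h.isExitPath_a i j).eq_end (h.val_aVertex_end_lt_aExit_zero hY hb j) hk ha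

theorem val_aFirst_of_aPath (h : IsFullOptimal F B) (hY : val B (.uNext i) = val B (.wNext i))
    (hb : BPath F i) {j : Fin r} (ha : APath F i j) :
    val B (.aFirst i j) = val B (.wNext i) := by
  rw [aFirst_eq_aVertex_zero h.pos_s]
  exact h.val_aVertex_of_forall_mem hY hb (Nat.zero_le _) fun k _ => ha k

theorem aPath (h : IsFullOptimal F B) (hY : val B (.uNext i) = val B (.wNext i))
    (hb : BPath F i) {j : Fin r} (ha : APath F i j) : APath B i j :=
  (h.isExitPath_a i j).used_of_avail (h.val_aVertex_end_lt_aExit_zero hY hb j) ha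

theorem val_a_of_notMem (h : IsFullOptimal F B) {j : Fin r} {k : Fin s}
    (hk : CEdge.a1 i j k ∉ F) : val B (.a i j k) = aExit B i k := by
  rw [← aVertex_val]
  exact (h.isExitPath_a i j).eq_exit (Or.inl ⟨k, le_rfl, hk⟩)

theorem val_aFirst_of_not_aPath (h : IsFullOptimal F B) {j : Fin r} (ha : ¬ APath F i j) :
    val B (.aFirst i j) = 2 * levelCost i + val B (.uNext i) := by
  obtain ⟨k, hk⟩ := not_forall.1 ha
  rw [aFirst_eq_aVertex_zero h.pos_s, ← aExit_zero]
  exact (h.isExitPath_a i j).eq_exit (j := ⟨0, h.pos_s⟩) (Or.inl ⟨k, Nat.zero_le _, hk⟩)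

theorem val_aFirst_of_le_bFirst (h : IsFullOptimal F B)
    (hb : 2 * levelCost i + 1 + val B (.uNext i) ≤ val B (.bFirst i)) (j : Fin r) :
    val B (.aFirst i j) = 2 * levelCost i + val B (.uNext i) := by
  rw [aFirst_eq_aVertex_zero h.pos_s, ← aExit_zero]
  refine (h.isExitPath_a i j).eq_exit (j := ⟨0, h.pos_s⟩) (Or.inr ?_)
  rw [aVertex_end]
  exact (aExit_end_le h.pos B i).trans hb

theorem a1_notMem_of_not_bPath (h : IsFullOptimal F B) (hb : ¬ BPath F i) (j : Fin r)
    (k : Fin s) : CEdge.a1 i j k ∉ B := by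
  refine (h.isExitPath_a i j).not_used (Or.inr ?_)
  rw [aVertex_end, h.val_bFirst_of_not_bPath hb]
  exact aExit_end_le h.pos B i

end IsFullOptimal

/-- The level is not broken: its `b`-path is interrupted, or some `a`-path is not. -/
def Sound (F : Finset (CEdge n r s t)) (i : Fin n) : Prop :=
  ¬ BPath F i ∨ ∃ j, APath F i j

namespace IsFullOptimal

theorem val_u_eq_val_w_of_aPath (h : IsFullOptimal F B)
    (hY : val B (.uNext i) = val B (.wNext i)) (hb : BPath F i) {j : Fin r} (ha : APath F i j) :
    val B (.u i) = val B (.w i) := by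
  have hL := one_le_levelCost i
  have hu : val B (.u i) = val B (.wNext i) := by
    rw [h.val_u_eq_min, h.val_bFirst_of_bPath hY hb, hY]
    exact min_eq_left (by linarith)
  have hw : val B (.w i) ≤ val B (.wNext i) :=
    (h.val_w_le_aFirst i j).trans_eq (h.val_aFirst_of_aPath hY hb ha)
  rw [hu]
  refine le_antisymm ?_ hw
  rcases h.val_w_eq_or i with ⟨j', hj'⟩ | hw0
  · by_cases ha' : APath F i j'
    · rw [hj', h.val_aFirst_of_aPath hY hb ha']
    · rw [hj', h.val_aFirst_of_not_aPath ha']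
      linarith
  · linarith

theorem val_u_eq_val_w_of_not_bPath (h : IsFullOptimal F B)
    (hY : val B (.uNext i) = val B (.wNext i)) (hb : ¬ BPath F i) :
    val B (.u i) = val B (.w i) := by
  have hL := one_le_levelCost i
  have hbFirst := h.val_bFirst_of_not_bPath hb
  have hu : val B (.u i) = levelCost i + val B (.uNext i) := by
    rw [h.val_u_eq_min, hbFirst]
    exact min_eq_right (by linarith)
  rcases h.val_w_eq_or i with ⟨j, hj⟩ | hw
  · rw [h.val_aFirst_of_le_bFirst hbFirst.ge] at hj
    linarith [h.val_w_le_wNext i]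
  · rw [hu, hw, hY]

theorem val_u_eq_val_w_of_sound (h : IsFullOptimal F B)
    (hY : val B (.uNext i) = val B (.wNext i)) (hi : Sound F i) : val B (.u i) = val B (.w i) := by
  by_cases hb : BPath F i
  · obtain ⟨j, ha⟩ := hi.resolve_left (not_not.2 hb)
    exact h.val_u_eq_val_w_of_aPath hY hb ha
  · exact h.val_u_eq_val_w_of_not_bPath hY hb

theorem val_uNext_eq_val_wNext (h : IsFullOptimal F B) (i : Fin n)
    (hi : ∀ x, i < x → Sound F x) : val B (.uNext i) = val B (.wNext i) := by
  induction hm : n - i.val generalizing i with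
  | zero => exact absurd i.2 (by omega)
  | succ m ih =>
    unfold CVertex.uNext CVertex.wNext
    split_ifs with hnext
    · have hlt : i < ⟨i.val + 1, hnext⟩ := Nat.lt_succ_self _
      refine h.val_u_eq_val_w_of_sound ?_ (hi _ hlt)
      exact ih _ (fun x hx => hi x (hlt.trans hx)) (by change n - (i.val + 1) = m; omega)
    · rfl

theorem val_u_add_le_val_w_of_broken (h : IsFullOptimal F B)
    (hY : val B (.uNext i) = val B (.wNext i)) (hi : ¬ Sound F i) :
    val B (.u i) + levelCost i ≤ val B (.w i) := by
  obtain ⟨hb, ha⟩ := not_or.1 hi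
  have hu : val B (.u i) ≤ val B (.wNext i) := by
    rw [h.val_u_eq_min, ← h.val_bFirst_of_bPath hY (not_not.1 hb)]
    exact min_le_left _ _
  rcases h.val_w_eq_or i with ⟨j, hj⟩ | hw
  · rw [h.val_aFirst_of_not_aPath (not_exists.1 ha j)] at hj
    linarith [one_le_levelCost i]
  · linarith

theorem val_u_add_le_val_w_of_reset (h : IsFullOptimal F B)
    (hY : val B (.uNext i) + 4 * levelCost i ≤ val B (.wNext i)) :
    val B (.u i) + levelCost i ≤ val B (.w i) ∧ ∀ j, CEdge.b1 i j ∉ B := by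
  have hL := one_le_levelCost i
  have hend : bExit B i (r * s) ≤ val B (bVertex i (r * s)) := by
    rw [bExit_end h.pos, bVertex_end]
    linarith
  have hb := h.isExitPath_b i
  refine ⟨?_, fun j => hb.not_used (Or.inr hend)⟩
  have hbFirst : 2 * levelCost i + 1 + val B (.uNext i) ≤ val B (.bFirst i) := by
    rw [bFirst_eq_bVertex_zero h.pos, ← bExit_zero]
    exact hb.exit_le (Nat.zero_le _) (Or.inr hend)
  have hu : val B (.u i) ≤ levelCost i + val B (.uNext i) :=
    (h.val_u_eq_min i).trans_le (min_le_right _ _)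
  rcases h.val_w_eq_or i with ⟨j, hj⟩ | hw
  · rw [h.val_aFirst_of_le_bFirst hbFirst] at hj
    linarith
  · linarith

theorem val_u_add_le_val_w_of_lt (h : IsFullOptimal F B)
    (hi : val B (.u i) + levelCost i ≤ val B (.w i)) {x : Fin n} (hx : x < i) :
    val B (.u x) + levelCost x ≤ val B (.w x) ∧ ∀ j, CEdge.b1 x j ∉ B := by
  induction hm : i.val - x.val generalizing x with
  | zero => exact absurd hx (by omega)
  | succ m ih =>
    have hnext : x.val + 1 < n := by omega
    refine h.val_u_add_le_val_w_of_reset ?_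
    have hle : val B (.u ⟨x.val + 1, hnext⟩) + levelCost ⟨x.val + 1, hnext⟩ ≤
        val B (.w ⟨x.val + 1, hnext⟩) := by
      rcases eq_or_lt_of_le (show ⟨x.val + 1, hnext⟩ ≤ i from hx) with rfl | hlt
      · exact hi
      · exact (ih hlt (by change i.val - (x.val + 1) = m; omega)).1
    rw [levelCost_succ hnext] at hle
    unfold CVertex.uNext CVertex.wNext
    rwa [dif_pos hnext, dif_pos hnext]

theorem b1_notMem_of_lt_broken (h : IsFullOptimal F B)
    (hY : val B (.uNext i) = val B (.wNext i)) (hi : ¬ Sound F i) {x : Fin n} (hx : x < i)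
    (j : Fin (r * s)) : CEdge.b1 x j ∉ B :=
  (h.val_u_add_le_val_w_of_lt (h.val_u_add_le_val_w_of_broken hY hi) hx).2 j

theorem improving_b1 {j : Fin (r * s)} (h : IsFullOptimal (F.erase (.b1 i j)) B)
    (hY : val B (.uNext i) = val B (.wNext i)) (hb : BPath F i) :
    (counterGraph n r s t).Improving B (.b1 i j) := by
  rw [h.isTree.improving_iff]
  change (0 : ℝ) + val B (bVertex i (j + 1)) < val B (.b i j)
  have hdst : val B (bVertex i (j + 1)) = val B (.wNext i) := by
    refine h.val_bVertex_of_forall_mem hY j.2 fun j' hj' => Finset.mem_erase.2 ⟨?_, hb j'⟩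
    rintro ⟨⟩
    exact absurd hj' (Nat.not_succ_le_self _)
  have hexit : bExit B i 0 ≤ bExit B i j := (strictMono_bExit h.pos B i).monotone (Nat.zero_le _)
  rw [zero_add, hdst, h.val_b_of_notMem (Finset.notMem_erase _ _), ← bVertex_end]
  exact (val_wNext_lt_bExit_zero hY).trans_le hexit

theorem improving_a1 {j : Fin r} {k : Fin s} (h : IsFullOptimal (F.erase (.a1 i j k)) B)
    (hY : val B (.uNext i) = val B (.wNext i)) (hb : BPath (F.erase (.a1 i j k)) i)
    (ha : APath F i j) : (counterGraph n r s t).Improving B (.a1 i j k) := by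
  rw [h.isTree.improving_iff]
  change (0 : ℝ) + val B (aVertex i j (k + 1)) < val B (.a i j k)
  have hdst : val B (aVertex i j (k + 1)) = val B (.wNext i) := by
    refine h.val_aVertex_of_forall_mem hY hb k.2 fun k' hk' => Finset.mem_erase.2 ⟨?_, ha k'⟩
    rintro ⟨⟩
    exact absurd hk' (Nat.not_succ_le_self _)
  have hexit : aExit B i 0 ≤ aExit B i k := (strictMono_aExit h.pos B i).monotone (Nat.zero_le _)
  rw [zero_add, hdst, h.val_a_of_notMem (Finset.notMem_erase _ _),
    ← h.val_bFirst_of_bPath hY hb, ← aVertex_end i j]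
  exact (h.val_aVertex_end_lt_aExit_zero hY hb j).trans_le hexit

end IsFullOptimal

section EraseSwitch

variable {x : Fin n} {j : Fin (r * s)} {l : Fin r} {k : Fin s}

theorem not_bPath_erase_b1 : ¬ BPath (F.erase (.b1 i j)) i :=
  fun h => Finset.notMem_erase _ _ (h j)

theorem bPath_erase_b1_iff (hx : x ≠ i) : BPath (F.erase (.b1 i j)) x ↔ BPath F x := by
  simp [BPath, Finset.mem_erase, hx]

theorem aPath_erase_b1_iff : APath (F.erase (.b1 i j)) x l ↔ APath F x l := by
  simp [APath, Finset.mem_erase]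

theorem not_aPath_erase_a1 : ¬ APath (F.erase (.a1 i l k)) i l :=
  fun h => Finset.notMem_erase _ _ (h k)

theorem bPath_erase_a1_iff : BPath (F.erase (.a1 i l k)) x ↔ BPath F x := by
  simp [BPath, Finset.mem_erase]

theorem aPath_erase_a1_iff {l' : Fin r} (hx : x ≠ i) :
    APath (F.erase (.a1 i l k)) x l' ↔ APath F x l' := by
  simp [APath, Finset.mem_erase, hx]

theorem bPath_switch_b1_iff (hx : x ≠ i) :
    BPath ((counterGraph n r s t).switch B (.b1 i j)) x ↔ BPath B x := by
  simp [BPath, PathInstance.mem_switch, counterGraph, CEdge.src, hx]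

theorem a1_mem_switch_b1 :
    CEdge.a1 x l k ∈ (counterGraph n r s t).switch B (.b1 i j) ↔ CEdge.a1 x l k ∈ B := by
  simp [PathInstance.mem_switch, counterGraph, CEdge.src]

theorem b1_mem_switch_a1 :
    CEdge.b1 x j ∈ (counterGraph n r s t).switch B (.a1 i l k) ↔ CEdge.b1 x j ∈ B := by
  simp [PathInstance.mem_switch, counterGraph, CEdge.src]

theorem aPath_switch_a1_iff {l' : Fin r} (hx : x ≠ i) :
    APath ((counterGraph n r s t).switch B (.a1 i l k)) x l' ↔ APath B x l' := by
  simp [APath, PathInstance.mem_switch, counterGraph, CEdge.src, hx]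

theorem sound_erase_b1 (hs : ∀ x, x ≠ i → Sound F x) (x : Fin n) :
    Sound (F.erase (.b1 i j)) x := by
  by_cases hx : x = i
  · subst hx
    exact Or.inl not_bPath_erase_b1
  · simpa only [Sound, bPath_erase_b1_iff hx, aPath_erase_b1_iff] using hs x hx

theorem sound_erase_a1_iff (hx : x ≠ i) : Sound (F.erase (.a1 i l k)) x ↔ Sound F x := by
  simp only [Sound, bPath_erase_a1_iff, aPath_erase_a1_iff hx]

end EraseSwitch

/-- The levels above `i` are settled: their bits do not change any more. -/
def Settled (F B : Finset (CEdge n r s t)) (i : ℕ) : Prop :=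
  ∀ x : Fin n, i < x.val → ¬ BPath F x ∨ (BPath B x ∧ ∃ j, APath B x j)

/-- The bits of the levels in `N` are active and have been reset; the bit of level `i` is set, and
its last `a`-path is about to be completed. The value `i = n` describes the initial call, where no
bit is set. -/
structure Counting (F B : Finset (CEdge n r s t)) (i : ℕ) (N : Finset (Fin n)) : Prop where
  settled : Settled F B i
  level : ∀ x : Fin n, x.val = i → BPath B x ∧ ∃! j, APath F x j
  lt : ∀ x ∈ N, x.val < i
  bPath : ∀ x ∈ N, BPath F x
  b1_notMem : ∀ x ∈ N, ∀ j, CEdge.b1 x j ∉ B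
  closed : ∀ x : Fin n, x.val < i → x ∉ N → ¬ BPath F x

/-- The bit of level `i` is being set, while the active bits of the levels below, which form the
set `N`, are still set. -/
structure Setting (F B : Finset (CEdge n r s t)) (i : Fin n) (N : Finset (Fin n)) : Prop where
  settled : Settled F B i
  level : BPath F i
  a1_notMem : ∀ j k, CEdge.a1 i j k ∉ B
  lt : ∀ x ∈ N, x < i
  bPath : ∀ x ∈ N, BPath B x
  aPath : ∀ x ∈ N, ∀ j, APath F x j → APath B x j
  closed : ∀ x, x < i → x ∉ N → ¬ BPath F x

theorem counting_univ {B₀ : Finset (CEdge n r s t)} (h0 : ∀ e ∈ B₀, e.IsZero) :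
    Counting Finset.univ B₀ n Finset.univ where
  settled x hx := absurd x.2 hx.not_gt
  level x hx := absurd x.2 hx.not_lt
  lt x _ := x.2
  bPath _ _ _ := Finset.mem_univ _
  b1_notMem _ _ _ hj := h0 _ hj
  closed x _ hx := absurd (Finset.mem_univ x) hx

section Erase

variable {m : ℕ} {e : CEdge n r s t}

theorem Settled.erase (h : Settled F B m) (e : CEdge n r s t) : Settled (F.erase e) B m :=
  fun x hx => (h x hx).imp_left (mt fun hb => hb.mono (Finset.erase_subset _ _))

theorem Settled.sound (h : Settled F B m) (hF : B ⊆ F) {x : Fin n} (hx : m < x.val) :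
    Sound F x :=
  (h x hx).imp_right fun ⟨_, j, hj⟩ => ⟨j, hj.mono hF⟩

theorem Counting.erase (h : Counting F B m N) (hb : ∀ x ∈ N, ∀ j, e ≠ .b1 x j)
    (ha : ∀ x : Fin n, x.val = m → ∀ j, APath F x j → ∀ k, e ≠ .a1 x j k) :
    Counting (F.erase e) B m N where
  settled := h.settled.erase e
  level x hx := by
    obtain ⟨hB, j, hj, huniq⟩ := h.level x hx
    exact ⟨hB, j, fun k => Finset.mem_erase.2 ⟨(ha x hx j hj k).symm, hj k⟩,
      fun j' hj' => huniq j' (APath.mono hj' (Finset.erase_subset _ _))⟩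
  lt := h.lt
  bPath x hx j := Finset.mem_erase.2 ⟨(hb x hx j).symm, h.bPath x hx j⟩
  b1_notMem := h.b1_notMem
  closed x hx hxN hb := h.closed x hx hxN (hb.mono (Finset.erase_subset _ _))

theorem Counting.erase_b1 (h : Counting F B m N) (x : Fin n) (j : Fin (r * s)) :
    Counting (F.erase (.b1 x j)) B m (N.erase x) where
  settled := h.settled.erase _
  level y hy := by simpa only [aPath_erase_b1_iff] using h.level y hy
  lt y hy := h.lt y (Finset.mem_of_mem_erase hy)
  bPath y hy := (bPath_erase_b1_iff (Finset.ne_of_mem_erase hy)).2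
    (h.bPath y (Finset.mem_of_mem_erase hy))
  b1_notMem y hy := h.b1_notMem y (Finset.mem_of_mem_erase hy)
  closed y hy hyN := by
    by_cases hyx : y = x
    · exact hyx ▸ not_bPath_erase_b1
    · rw [bPath_erase_b1_iff hyx]
      exact h.closed y hy fun hN => hyN (Finset.mem_erase.2 ⟨hyx, hN⟩)

theorem Setting.erase (h : Setting F B i N) (hb : ∀ j, e ≠ .b1 i j) :
    Setting (F.erase e) B i N where
  settled := h.settled.erase e
  level j := Finset.mem_erase.2 ⟨(hb j).symm, h.level j⟩
  a1_notMem := h.a1_notMem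
  lt := h.lt
  bPath := h.bPath
  aPath x hx j hj := h.aPath x hx j (hj.mono (Finset.erase_subset _ _))
  closed x hx hxN hb := h.closed x hx hxN (hb.mono (Finset.erase_subset _ _))

end Erase

section Switch

variable {j : Fin (r * s)} {l : Fin r} {k : Fin s}

theorem setting_switch_b1 (h : IsFullOptimal (F.erase (.b1 i j)) B)
    (hs : ∀ x, x ≠ i → Sound F x) (hi : BPath F i) (hlt : ∀ x ∈ N, x < i)
    (hact : ∀ x ∈ N, BPath F x) (hclosed : ∀ x, x < i → x ∉ N → ¬ BPath F x) :
    (counterGraph n r s t).Improving B (.b1 i j) ∧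
      Setting F ((counterGraph n r s t).switch B (.b1 i j)) i N := by
  have hY : ∀ x, val B (.uNext x) = val B (.wNext x) := fun x =>
    h.val_uNext_eq_val_wNext x fun y _ => sound_erase_b1 hs y
  have hbPath : ∀ x, x ≠ i → BPath F x →
      BPath ((counterGraph n r s t).switch B (.b1 i j)) x := fun x hx hb =>
    (bPath_switch_b1_iff hx).2 (h.bPath (hY x) ((bPath_erase_b1_iff hx).2 hb))
  have haPath : ∀ x, x ≠ i → BPath F x → ∀ l, APath F x l →
      APath ((counterGraph n r s t).switch B (.b1 i j)) x l := fun x hx hb l ha k =>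
    a1_mem_switch_b1.2 (h.aPath (hY x) ((bPath_erase_b1_iff hx).2 hb) (aPath_erase_b1_iff.2 ha) k)
  refine ⟨h.improving_b1 (hY i) hi, ?_, hi, ?_, hlt, ?_, ?_, hclosed⟩
  · intro x hx
    have hxi : x ≠ i := fun heq => hx.ne (congrArg Fin.val heq.symm)
    by_cases hb : BPath F x
    · obtain ⟨l, hl⟩ := (hs x hxi).resolve_left (not_not.2 hb)
      exact Or.inr ⟨hbPath x hxi hb, l, haPath x hxi hb l hl⟩
    · exact Or.inl hb
  · exact fun l k hk => h.a1_notMem_of_not_bPath not_bPath_erase_b1 l k (a1_mem_switch_b1.1 hk)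
  · exact fun x hx => hbPath x (hlt x hx).ne (hact x hx)
  · exact fun x hx => haPath x (hlt x hx).ne (hact x hx)

theorem Counting.switch_b1 {m : ℕ} (h : Counting F B m N) (hF : B ⊆ F)
    (hN : ∀ x ∈ N, ∃ l, APath F x l) (hi : i ∈ N)
    (hopt : IsFullOptimal (F.erase (.b1 i j)) B') :
    (counterGraph n r s t).Improving B' (.b1 i j) ∧
      Setting F ((counterGraph n r s t).switch B' (.b1 i j)) i {x ∈ N | x < i} := by
  have hsound : ∀ x, Sound F x := by
    intro x
    rcases lt_trichotomy x.val m with hx | hx | hx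
    · by_cases hxN : x ∈ N
      · exact Or.inr (hN x hxN)
      · exact Or.inl (h.closed x hx hxN)
    · exact Or.inr (h.level x hx).2.exists
    · exact h.settled.sound hF hx
  refine setting_switch_b1 hopt (fun x _ => hsound x) (h.bPath i hi)
    (fun x hx => (Finset.mem_filter.1 hx).2) (fun x hx => h.bPath x (Finset.mem_filter.1 hx).1)
    fun x hx hxN => h.closed x (lt_trans hx (h.lt i hi)) fun hx' => ?_
  exact hxN (Finset.mem_filter.2 ⟨hx', hx⟩)

theorem Setting.switch_b1 (h : Setting F B i N) (hF : B ⊆ F)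
    (hN : ∀ x ∈ N, ∃ l, APath F x l) (hopt : IsFullOptimal (F.erase (.b1 i j)) B') :
    (counterGraph n r s t).Improving B' (.b1 i j) ∧
      Setting F ((counterGraph n r s t).switch B' (.b1 i j)) i N := by
  have hsound : ∀ x, x ≠ i → Sound F x := by
    intro x hxi
    rcases lt_or_gt_of_ne hxi with hx | hx
    · by_cases hxN : x ∈ N
      · exact Or.inr (hN x hxN)
      · exact Or.inl (h.closed x hx hxN)
    · exact h.settled.sound hF hx
  exact setting_switch_b1 hopt hsound h.level h.lt (fun x hx => (h.bPath x hx).mono hF) h.closed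

theorem counting_switch_a1 (h : IsFullOptimal (F.erase (.a1 i l k)) B)
    (hs : ∀ x, i < x → Sound F x) (hi : BPath F i) (ha : APath F i l)
    (huniq : ∀ l', APath F i l' → l' = l) (hlt : ∀ x ∈ N, x < i) (hact : ∀ x ∈ N, BPath F x)
    (hclosed : ∀ x, x < i → x ∉ N → ¬ BPath F x) :
    (counterGraph n r s t).Improving B (.a1 i l k) ∧
      Counting F ((counterGraph n r s t).switch B (.a1 i l k)) i N := by
  have hY : ∀ x, i ≤ x → val B (.uNext x) = val B (.wNext x) := fun x hx =>
    h.val_uNext_eq_val_wNext x fun y hy =>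
      (sound_erase_a1_iff (hx.trans_lt hy).ne').2 (hs y (hx.trans_lt hy))
  have hi' : BPath (F.erase (.a1 i l k)) i := bPath_erase_a1_iff.2 hi
  have hbroken : ¬ Sound (F.erase (.a1 i l k)) i := by
    rintro (hb | ⟨l', hl'⟩)
    · exact hb hi'
    · obtain rfl := huniq l' (hl'.mono (Finset.erase_subset _ _))
      exact not_aPath_erase_a1 hl'
  have hbPath : ∀ x, i ≤ x → BPath F x →
      BPath ((counterGraph n r s t).switch B (.a1 i l k)) x := fun x hx hb j =>
    b1_mem_switch_a1.2 (h.bPath (hY x hx) (bPath_erase_a1_iff.2 hb) j)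
  refine ⟨h.improving_a1 (hY i le_rfl) hi' ha, ?_, ?_, hlt, hact, ?_, hclosed⟩
  · intro x hx
    by_cases hb : BPath F x
    · obtain ⟨l', hl'⟩ := (hs x hx).resolve_left (not_not.2 hb)
      have hxi : x ≠ i := ne_of_gt hx
      exact Or.inr ⟨hbPath x (le_of_lt hx) hb, l', (aPath_switch_a1_iff hxi).2
        (h.aPath (hY x (le_of_lt hx)) (bPath_erase_a1_iff.2 hb) ((aPath_erase_a1_iff hxi).2 hl'))⟩
    · exact Or.inl hb
  · intro x hx
    obtain rfl := Fin.ext hx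
    exact ⟨hbPath x le_rfl hi, l, ha, huniq⟩
  · exact fun x hx j hj => h.b1_notMem_of_lt_broken (hY i le_rfl) hbroken (hlt x hx) j
      (b1_mem_switch_a1.1 hj)

theorem Counting.switch_a1 (h : Counting F B i N) (hF : B ⊆ F) (ha : APath F i l)
    (hopt : IsFullOptimal (F.erase (.a1 i l k)) B') :
    (counterGraph n r s t).Improving B' (.a1 i l k) ∧
      Counting F ((counterGraph n r s t).switch B' (.a1 i l k)) i N :=
  counting_switch_a1 hopt (fun _ hx => h.settled.sound hF hx) ((h.level i rfl).1.mono hF) ha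
    (fun _ hl => (h.level i rfl).2.unique hl ha) h.lt h.bPath h.closed

theorem Setting.switch_a1 (h : Setting F B i N) (hF : B ⊆ F) (ha : APath F i l)
    (huniq : ∀ l', APath F i l' → l' = l) (hopt : IsFullOptimal (F.erase (.a1 i l k)) B') :
    (counterGraph n r s t).Improving B' (.a1 i l k) ∧
      Counting F ((counterGraph n r s t).switch B' (.a1 i l k)) i N :=
  counting_switch_a1 hopt (fun _ hx => h.settled.sound hF hx) h.level ha huniq h.lt
    (fun x hx => (h.bPath x hx).mono hF) h.closed

end Switch

end CounterGraph

theorem sum_pow_erase_sub_le {E : Type*} [DecidableEq E] {p : ℝ} (hp : 0 < p) (hp1 : p ≤ 1)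
    (q : Finset E → ℕ) (F T Z : Finset E) (hle : ∀ e, q F ≤ q (F.erase e) + 1)
    (heq : ∀ e ∉ Z, q (F.erase e) = q F) :
    ∑ e ∈ T, (p ^ q (F.erase e) - p ^ q F) ≤ (Z.card : ℝ) * (p⁻¹ * p ^ q F) := by
  have hterm : ∀ e, p ^ q (F.erase e) - p ^ q F ≤ p⁻¹ * p ^ q F := by
    intro e
    have hpow : p ^ (q (F.erase e) + 1) ≤ p ^ q F := pow_le_pow_of_le_one hp.le hp1 (hle e)
    rw [pow_succ'] at hpow
    exact (sub_le_self _ (by positivity)).trans ((le_inv_mul_iff₀ hp).2 hpow)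
  calc ∑ e ∈ T, (p ^ q (F.erase e) - p ^ q F)
      = ∑ e ∈ T ∩ Z, (p ^ q (F.erase e) - p ^ q F) := by
        refine (Finset.sum_subset Finset.inter_subset_left fun e he heZ => ?_).symm
        rw [heq e fun h => heZ (Finset.mem_inter.2 ⟨he, h⟩), sub_self]
    _ ≤ ∑ _ ∈ T ∩ Z, p⁻¹ * p ^ q F := Finset.sum_le_sum fun e _ => hterm e
    _ = ((T ∩ Z).card : ℝ) * (p⁻¹ * p ^ q F) := by rw [Finset.sum_const, nsmul_eq_mul]
    _ ≤ (Z.card : ℝ) * (p⁻¹ * p ^ q F) := by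
        gcongr
        exact Finset.inter_subset_right

theorem exists_top_subset {α : Type*} [LinearOrder α] (N : Finset α) (g : ℕ) (hg : g ≤ N.card) :
    ∃ T ⊆ N, T.card = g ∧ ∀ y ∈ T, N.card ≤ (N.filter (· < y)).card + g := by
  induction g generalizing N with
  | zero => exact ⟨∅, Finset.empty_subset _, rfl, fun y hy => absurd hy (Finset.notMem_empty y)⟩
  | succ g ih =>
    have hne : N.Nonempty := Finset.card_pos.1 (by omega)
    set m := N.max' hne with hm
    have hcard := Finset.card_erase_add_one (N.max'_mem hne)
    rw [← hm] at hcard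
    obtain ⟨T, hT, hTc, hTy⟩ := ih (N.erase m) (by omega)
    have hmT : m ∉ T := fun h => Finset.notMem_erase m N (hT h)
    refine ⟨insert m T, Finset.insert_subset (N.max'_mem hne) (hT.trans (Finset.erase_subset _ _)),
      by rw [Finset.card_insert_of_notMem hmT, hTc], fun y hy => ?_⟩
    rcases Finset.mem_insert.1 hy with rfl | hy
    · have hsub : N.erase m ⊆ N.filter (· < m) := fun z hz =>
        Finset.mem_filter.2 ⟨Finset.mem_of_mem_erase hz,
          lt_of_le_of_ne (N.le_max' z (Finset.mem_of_mem_erase hz)) (Finset.ne_of_mem_erase hz)⟩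
      have := Finset.card_le_card hsub
      omega
    · have hsub := Finset.card_le_card
        (Finset.filter_subset_filter (· < y) (Finset.erase_subset m N))
      have := hTy y hy
      omega

theorem card_mul_one_sub_le_sum {E : Type*} {A : Finset E} {c κ W : ℝ} {L : E → ℝ} (hc : 0 ≤ c)
    (hκ : 0 ≤ κ) (h : ∑ e ∈ A, L e ≤ A.card * W) :
    (A.card : ℝ) * (c * (1 - κ * W)) ≤ ∑ e ∈ A, c * (1 - κ * L e) := by
  rw [← Finset.mul_sum, Finset.sum_sub_distrib, ← Finset.mul_sum, Finset.sum_const, nsmul_eq_mul,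
    mul_one]
  calc (A.card : ℝ) * (c * (1 - κ * W)) = c * (A.card - κ * (A.card * W)) := by ring
    _ ≤ c * (A.card - κ * ∑ e ∈ A, L e) := by gcongr

namespace CounterGraph

variable {n r s t : ℕ} {F B : Finset (CEdge n r s t)} {N : Finset (Fin n)}

section Weights

/-- The number of copies of a multi-edge in `F`. -/
def copies (m : MultiEdge n r s) (F : Finset (CEdge n r s t)) : ℕ :=
  (Finset.univ.filter fun l => m.copy l ∈ F).card

open Classical in
/-- The `a`-paths of level `i` in `F`. -/
noncomputable def aPaths (F : Finset (CEdge n r s t)) (i : Fin n) : Finset (Fin r) :=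
  Finset.univ.filter fun j => APath F i j

/-- The edges of the `b`-paths of the levels in `M`. -/
def bEdges (r s t : ℕ) (M : Finset (Fin n)) : Finset (CEdge n r s t) :=
  (M ×ˢ Finset.univ).image fun xj => .b1 xj.1 xj.2

/-- The edges of the `a`-paths in `J` of level `i`. -/
def aEdges (s t : ℕ) (i : Fin n) (J : Finset (Fin r)) : Finset (CEdge n r s t) :=
  (J ×ˢ Finset.univ).image fun jk => .a1 i jk.1 jk.2

theorem mem_aPaths {i : Fin n} {j : Fin r} : j ∈ aPaths F i ↔ APath F i j := by
  simp [aPaths]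

theorem mem_bEdges {M : Finset (Fin n)} {e : CEdge n r s t} :
    e ∈ bEdges r s t M ↔ ∃ x ∈ M, ∃ j, e = .b1 x j := by
  simp only [bEdges, Finset.mem_image, Finset.mem_product, Finset.mem_univ, and_true, Prod.exists,
    eq_comm (a := e), exists_and_left]

theorem mem_aEdges {i : Fin n} {J : Finset (Fin r)} {e : CEdge n r s t} :
    e ∈ aEdges s t i J ↔ ∃ j ∈ J, ∃ k, e = .a1 i j k := by
  simp only [aEdges, Finset.mem_image, Finset.mem_product, Finset.mem_univ, and_true, Prod.exists,
    eq_comm (a := e), exists_and_left]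

theorem b1_mem_bEdges {M : Finset (Fin n)} {x : Fin n} {j : Fin (r * s)} :
    .b1 x j ∈ bEdges r s t M ↔ x ∈ M := by
  rw [mem_bEdges]
  constructor
  · rintro ⟨y, hy, j', h⟩
    exact (CEdge.b1.inj h).1 ▸ hy
  · exact fun hx => ⟨x, hx, j, rfl⟩

theorem card_bEdges (M : Finset (Fin n)) : (bEdges r s t M).card = M.card * (r * s) := by
  rw [bEdges, Finset.card_image_of_injective, Finset.card_product, Finset.card_univ,
    Fintype.card_fin]
  rintro ⟨x, j⟩ ⟨x', j'⟩ h
  simpa using h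

theorem card_aEdges (i : Fin n) (J : Finset (Fin r)) : (aEdges s t i J).card = J.card * s := by
  rw [aEdges, Finset.card_image_of_injective, Finset.card_product, Finset.card_univ,
    Fintype.card_fin]
  rintro ⟨j, k⟩ ⟨j', k'⟩ h
  simpa using h

theorem copies_erase_le (m : MultiEdge n r s) (F : Finset (CEdge n r s t)) (e : CEdge n r s t) :
    copies m (F.erase e) ≤ copies m F :=
  Finset.card_le_card (Finset.monotone_filter_right _ fun _ _ => Finset.mem_of_mem_erase)

theorem copies_erase_of_notMem (m : MultiEdge n r s) (F : Finset (CEdge n r s t))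
    {e : CEdge n r s t} (he : e ∉ Finset.univ.image (m.copy : Fin t → CEdge n r s t)) :
    copies m (F.erase e) = copies m F := by
  have hne : ∀ l, m.copy l ≠ e := fun l h => he (Finset.mem_image.2 ⟨l, Finset.mem_univ _, h⟩)
  simp only [copies, Finset.mem_erase, hne, ne_eq, not_false_eq_true, true_and]

theorem copies_le_erase_add_one (m : MultiEdge n r s) (F : Finset (CEdge n r s t))
    (e : CEdge n r s t) : copies m F ≤ copies m (F.erase e) + 1 := by
  by_cases he : e ∈ Finset.univ.image (m.copy : Fin t → CEdge n r s t)
  · obtain ⟨l, -, rfl⟩ := Finset.mem_image.1 he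
    refine (Finset.card_le_card fun l' hl' => ?_).trans (Finset.card_insert_le l _)
    rw [Finset.mem_filter] at hl'
    rw [Finset.mem_insert, Finset.mem_filter, Finset.mem_erase, m.copy_injective.ne_iff]
    exact (eq_or_ne l' l).imp_right fun h => ⟨Finset.mem_univ _, h, hl'.2⟩
  · rw [copies_erase_of_notMem m F he]
    exact Nat.le_succ _

theorem aPaths_erase_of_notMem {i : Fin n} {e : CEdge n r s t}
    (he : e ∉ aEdges s t i (aPaths F i)) : aPaths (F.erase e) i = aPaths F i := by
  ext j
  rw [mem_aPaths, mem_aPaths]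
  refine ⟨fun h => h.mono (Finset.erase_subset _ _), fun h k => Finset.mem_erase.2 ⟨?_, h k⟩⟩
  rintro rfl
  exact he (mem_aEdges.2 ⟨j, mem_aPaths.2 h, k, rfl⟩)

theorem aPaths_erase_a1 (F : Finset (CEdge n r s t)) (i : Fin n) (j : Fin r) (k : Fin s) :
    aPaths (F.erase (.a1 i j k)) i = (aPaths F i).erase j := by
  ext j'
  rw [Finset.mem_erase, mem_aPaths, mem_aPaths]
  constructor
  · refine fun h => ⟨?_, h.mono (Finset.erase_subset _ _)⟩
    rintro rfl
    exact Finset.notMem_erase _ _ (h k)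
  · exact fun ⟨hne, h⟩ k' => Finset.mem_erase.2 ⟨fun h' => hne (CEdge.a1.inj h').2.1, h k'⟩

theorem card_aPaths_erase_le (i : Fin n) (F : Finset (CEdge n r s t)) (e : CEdge n r s t) :
    (aPaths (F.erase e) i).card ≤ (aPaths F i).card :=
  Finset.card_le_card fun _ hj =>
    mem_aPaths.2 ((mem_aPaths.1 hj).mono (Finset.erase_subset _ _))

theorem card_aPaths_le_erase_add_one (i : Fin n) (F : Finset (CEdge n r s t))
    (e : CEdge n r s t) : (aPaths F i).card ≤ (aPaths (F.erase e) i).card + 1 := by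
  by_cases he : e ∈ aEdges s t i (aPaths F i)
  · obtain ⟨j, -, k, rfl⟩ := mem_aEdges.1 he
    rw [aPaths_erase_a1]
    exact Nat.sub_le_iff_le_add.1 Finset.pred_card_le_card_erase
  · rw [aPaths_erase_of_notMem he]
    exact Nat.le_succ _

/-- The sum of `p` to the number of copies, over all multi-edges. -/
noncomputable def copyWeight (p : ℝ) (F : Finset (CEdge n r s t)) : ℝ :=
  ∑ m : MultiEdge n r s, p ^ copies m F

/-- The sum of `p` to the number of complete `a`-paths, over the levels in `N`. -/
noncomputable def pathWeight (p : ℝ) (N : Finset (Fin n)) (F : Finset (CEdge n r s t)) : ℝ :=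
  ∑ x ∈ N, p ^ (aPaths F x).card

variable {p : ℝ}

theorem copyWeight_nonneg (hp : 0 ≤ p) (F : Finset (CEdge n r s t)) : 0 ≤ copyWeight p F :=
  Finset.sum_nonneg fun _ _ => pow_nonneg hp _

theorem pathWeight_nonneg (hp : 0 ≤ p) (N : Finset (Fin n)) (F : Finset (CEdge n r s t)) :
    0 ≤ pathWeight p N F :=
  Finset.sum_nonneg fun _ _ => pow_nonneg hp _

theorem copyWeight_le_erase (hp : 0 ≤ p) (hp1 : p ≤ 1) (F : Finset (CEdge n r s t))
    (e : CEdge n r s t) : copyWeight p F ≤ copyWeight p (F.erase e) :=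
  Finset.sum_le_sum fun m _ => pow_le_pow_of_le_one hp hp1 (copies_erase_le m F e)

theorem pathWeight_le_erase (hp : 0 ≤ p) (hp1 : p ≤ 1) (N : Finset (Fin n))
    (F : Finset (CEdge n r s t)) (e : CEdge n r s t) :
    pathWeight p N F ≤ pathWeight p N (F.erase e) :=
  Finset.sum_le_sum fun x _ => pow_le_pow_of_le_one hp hp1 (card_aPaths_erase_le x F e)

theorem pathWeight_mono (hp : 0 ≤ p) {N N' : Finset (Fin n)} (h : N ⊆ N')
    (F : Finset (CEdge n r s t)) : pathWeight p N F ≤ pathWeight p N' F :=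
  Finset.sum_le_sum_of_subset_of_nonneg h fun _ _ _ => pow_nonneg hp _

theorem hasCopies_of_copyWeight_lt_one (hp : 0 ≤ p) (h : copyWeight p F < 1) : HasCopies F := by
  intro m
  by_contra! hm
  have hle : p ^ copies m F ≤ copyWeight p F :=
    Finset.single_le_sum (f := fun m => p ^ copies m F) (fun _ _ => pow_nonneg hp _)
      (Finset.mem_univ m)
  rw [copies, Finset.filter_false_of_mem fun l _ => hm l, Finset.card_empty, pow_zero] at hle
  exact hle.not_gt h

theorem exists_aPath_of_pathWeight_lt_one (hp : 0 ≤ p) (h : pathWeight p N F < 1) {x : Fin n}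
    (hx : x ∈ N) : ∃ j, APath F x j := by
  by_contra! hj
  have hle : p ^ (aPaths F x).card ≤ pathWeight p N F :=
    Finset.single_le_sum (f := fun x => p ^ (aPaths F x).card) (fun _ _ => pow_nonneg hp _) hx
  rw [Finset.eq_empty_of_forall_notMem fun j h => hj j (mem_aPaths.1 h), Finset.card_empty,
    pow_zero] at hle
  exact hle.not_gt h

theorem sum_copyWeight_erase_sub_le (hp : 0 < p) (hp1 : p ≤ 1) (F T : Finset (CEdge n r s t)) :
    ∑ e ∈ T, (copyWeight p (F.erase e) - copyWeight p F) ≤ (t : ℝ) * (p⁻¹ * copyWeight p F) := by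
  simp only [copyWeight, ← Finset.sum_sub_distrib]
  rw [Finset.sum_comm, Finset.mul_sum, Finset.mul_sum]
  refine Finset.sum_le_sum fun m _ => ?_
  have h := sum_pow_erase_sub_le hp hp1 (copies m) F T (Finset.univ.image m.copy)
    (copies_le_erase_add_one m F) fun e => copies_erase_of_notMem m F
  rwa [Finset.card_image_of_injective _ m.copy_injective, Finset.card_univ,
    Fintype.card_fin] at h

theorem sum_pathWeight_erase_sub_le (hp : 0 < p) (hp1 : p ≤ 1) (N : Finset (Fin n))
    (F T : Finset (CEdge n r s t)) :
    ∑ e ∈ T, (pathWeight p N (F.erase e) - pathWeight p N F) ≤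
      ((r * s : ℕ) : ℝ) * (p⁻¹ * pathWeight p N F) := by
  simp only [pathWeight, ← Finset.sum_sub_distrib]
  rw [Finset.sum_comm, Finset.mul_sum, Finset.mul_sum]
  refine Finset.sum_le_sum fun x _ => ?_
  refine (sum_pow_erase_sub_le hp hp1 (fun F => (aPaths F x).card) F T
    (aEdges s t x (aPaths F x)) (card_aPaths_le_erase_add_one x F)
    fun e he => by rw [aPaths_erase_of_notMem he]).trans ?_
  rw [card_aEdges]
  gcongr
  exact (Finset.card_le_univ _).trans_eq (Fintype.card_fin r)

end Weights

/-- The parameters of the potential functions: `p` weighs the edges that may get lost, `K` and `η`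
are the discounts per counted bit and per interrupted `a`-path, `S` is the number of levels that may
be lost without being counted, and `g` is the number of levels that are candidates for a bit. -/
structure Params (n r s t : ℕ) where
  p : ℝ
  K : ℝ
  η : ℝ
  S : ℝ
  g : ℕ
  p_pos : 0 < p
  p_le : p ≤ 1
  one_le_K : 1 ≤ K
  one_le_η : 1 ≤ η
  S_pos : 0 < S
  g_pos : 0 < g
  rs_pos : 0 < r * s
  counting_drift : (4 * n / S + p⁻¹) * (r * s : ℕ) + t * p⁻¹ ≤ g * (r * s : ℕ) * (1 - K⁻¹)
  setting_drift : t * p⁻¹ ≤ s * (1 - η⁻¹)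

namespace Params

variable (P : Params n r s t) {h : ℝ} {i : Fin n} {m k x q : ℕ} {e : CEdge n r s t}

theorem K_pos : 0 < P.K := one_pos.trans_le P.one_le_K

theorem η_pos : 0 < P.η := one_pos.trans_le P.one_le_η

section Loss

/-- The fraction of the value `2 ^ k` that is given up, before discounting, after `h` levels have
been lost and while `q` more `a`-paths may get interrupted. -/
noncomputable def loss (h : ℝ) (q : ℕ) (N : Finset (Fin n)) (F : Finset (CEdge n r s t)) : ℝ :=
  1 / 4 + h / P.S + pathWeight P.p N F + P.η ^ q * copyWeight P.p F

theorem η_pow_mul_copyWeight_nonneg (q : ℕ) (F : Finset (CEdge n r s t)) :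
    0 ≤ P.η ^ q * copyWeight P.p F :=
  mul_nonneg (pow_nonneg P.η_pos.le q) (copyWeight_nonneg P.p_pos.le F)

theorem one_div_four_le_loss (h0 : 0 ≤ h) (q : ℕ) (N : Finset (Fin n))
    (F : Finset (CEdge n r s t)) : 1 / 4 ≤ P.loss h q N F := by
  have hS : 0 ≤ h / P.S := div_nonneg h0 P.S_pos.le
  have hp := pathWeight_nonneg P.p_pos.le N F
  have hc := P.η_pow_mul_copyWeight_nonneg q F
  rw [loss]
  linarith

theorem loss_nonneg (h0 : 0 ≤ h) (q : ℕ) (N : Finset (Fin n)) (F : Finset (CEdge n r s t)) :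
    0 ≤ P.loss h q N F :=
  (by norm_num : (0 : ℝ) ≤ 1 / 4).trans (P.one_div_four_le_loss h0 q N F)

theorem loss_le_erase (h : ℝ) (q : ℕ) (N : Finset (Fin n)) (F : Finset (CEdge n r s t))
    (e : CEdge n r s t) : P.loss h q N F ≤ P.loss h q N (F.erase e) :=
  add_le_add (add_le_add_right (pathWeight_le_erase P.p_pos.le P.p_le N F e) _)
    (mul_le_mul_of_nonneg_left (copyWeight_le_erase P.p_pos.le P.p_le F e)
      (pow_nonneg P.η_pos.le q))

theorem loss_mono (h : ℝ) {q q' : ℕ} (hq : q ≤ q') {N N' : Finset (Fin n)} (hN : N ⊆ N')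
    (F : Finset (CEdge n r s t)) : P.loss h q N F ≤ P.loss h q' N' F :=
  add_le_add (add_le_add_right (pathWeight_mono P.p_pos.le hN F) _)
    (mul_le_mul_of_nonneg_right (pow_le_pow_right₀ P.one_le_η hq)
      (copyWeight_nonneg P.p_pos.le F))

theorem loss_add_one (h : ℝ) (q : ℕ) (N : Finset (Fin n)) (F : Finset (CEdge n r s t)) :
    P.loss (h + 1) q N F = P.loss h q N F + 1 / P.S := by
  rw [loss, loss]
  ring

theorem sum_loss_erase_sub_le (h0 : 0 ≤ h) (q : ℕ) (N : Finset (Fin n))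
    (F T : Finset (CEdge n r s t)) :
    ∑ e ∈ T, (P.loss h q N (F.erase e) - P.loss h q N F) ≤
      ((r * s : ℕ) * P.p⁻¹ + t * P.p⁻¹) * P.loss h q N F := by
  have hsum : ∑ e ∈ T, (P.loss h q N (F.erase e) - P.loss h q N F) =
      ∑ e ∈ T, (pathWeight P.p N (F.erase e) - pathWeight P.p N F) +
        P.η ^ q * ∑ e ∈ T, (copyWeight P.p (F.erase e) - copyWeight P.p F) := by
    rw [Finset.mul_sum, ← Finset.sum_add_distrib]
    refine Finset.sum_congr rfl fun e _ => ?_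
    rw [loss, loss]
    ring
  have hS : 0 ≤ h / P.S := div_nonneg h0 P.S_pos.le
  have hp := P.p_pos
  have hη := P.η_pos
  have hpath : pathWeight P.p N F ≤ P.loss h q N F := by
    have := P.η_pow_mul_copyWeight_nonneg q F
    rw [loss]
    linarith
  have hcopy : P.η ^ q * copyWeight P.p F ≤ P.loss h q N F := by
    have := pathWeight_nonneg hp.le N F
    rw [loss]
    linarith
  calc _ ≤ (r * s : ℕ) * (P.p⁻¹ * pathWeight P.p N F) +
          P.η ^ q * (t * (P.p⁻¹ * copyWeight P.p F)) := by
        rw [hsum]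
        gcongr
        · exact sum_pathWeight_erase_sub_le hp P.p_le N F T
        · exact sum_copyWeight_erase_sub_le hp P.p_le F T
    _ = (r * s : ℕ) * (P.p⁻¹ * pathWeight P.p N F) +
          t * (P.p⁻¹ * (P.η ^ q * copyWeight P.p F)) := by ring
    _ ≤ (r * s : ℕ) * (P.p⁻¹ * P.loss h q N F) + t * (P.p⁻¹ * P.loss h q N F) := by gcongr
    _ = _ := by ring

variable {P}

theorem loss_lt_one_of_pos {c : ℝ} (hc : 0 ≤ c) (h0 : 0 ≤ h)
    (hpos : 0 < c * (1 - P.K ^ m * P.loss h q N F)) : P.loss h q N F < 1 :=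
  (le_mul_of_one_le_left (P.loss_nonneg h0 q N F) (one_le_pow₀ P.one_le_K)).trans_lt
    (sub_pos.1 (pos_of_mul_pos_right hpos hc))

theorem hasCopies_of_loss_lt_one (h0 : 0 ≤ h) (hl : P.loss h q N F < 1) : HasCopies F := by
  have hS : 0 ≤ h / P.S := div_nonneg h0 P.S_pos.le
  have hp := pathWeight_nonneg P.p_pos.le N F
  have hc : copyWeight P.p F ≤ P.η ^ q * copyWeight P.p F :=
    le_mul_of_one_le_left (copyWeight_nonneg P.p_pos.le F) (one_le_pow₀ P.one_le_η)
  rw [loss] at hl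
  exact hasCopies_of_copyWeight_lt_one P.p_pos.le (by linarith)

theorem exists_aPath_of_loss_lt_one (h0 : 0 ≤ h) (hl : P.loss h q N F < 1) :
    ∀ x ∈ N, ∃ j, APath F x j := by
  have hS : 0 ≤ h / P.S := div_nonneg h0 P.S_pos.le
  have hc := P.η_pow_mul_copyWeight_nonneg q F
  rw [loss] at hl
  exact fun x => exists_aPath_of_pathWeight_lt_one P.p_pos.le (by linarith)

theorem le_card_of_loss_lt_one {y : ℝ} (hl : P.loss h q N F < 1) (hy : y + P.S ≤ N.card + h) :
    y ≤ N.card := by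
  have hp := pathWeight_nonneg P.p_pos.le N F
  have hc := P.η_pow_mul_copyWeight_nonneg q F
  rw [loss] at hl
  have hS : h / P.S < 1 := by linarith
  rw [div_lt_one P.S_pos] at hS
  linarith

end Loss

/-- The potential while `k + 1` more bits are to be set, the next of them in `x` ways. -/
noncomputable def countingValue (k x : ℕ) (h : ℝ) (N : Finset (Fin n))
    (F : Finset (CEdge n r s t)) : ℝ :=
  x * 2 ^ k * (1 - P.K ^ (2 * k + x) * P.loss h (r * (k + 1)) N F)

/-- The potential while a bit of a level with `q` complete `a`-paths is being set and `k` more bits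
are to be set thereafter. -/
noncomputable def settingValue (k q : ℕ) (h : ℝ) (N : Finset (Fin n))
    (F : Finset (CEdge n r s t)) : ℝ :=
  2 ^ k * (1 - P.K ^ (2 * k) * P.loss h (r * k + q) N F)

/-- The potential functions bound the expected number of switches from below. -/
structure Bound (F B : Finset (CEdge n r s t)) : Prop where
  counting {m : ℕ} {N : Finset (Fin n)} {k : ℕ} (x : ℕ) {h : ℝ} : Counting F B m N → 0 ≤ h →
    (P.g : ℝ) * (k + 1) + P.S ≤ N.card + h →
    ENNReal.ofReal (P.countingValue k x h N F) ≤
      1 + expectedSwitches (counterGraph n r s t) F B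
  setting {i : Fin n} {N : Finset (Fin n)} {k : ℕ} {h : ℝ} : Setting F B i N → 0 ≤ h →
    (P.g : ℝ) * k + P.S ≤ N.card + h → (∃ j, APath F i j) →
    ENNReal.ofReal (P.settingValue k (aPaths F i).card h N F) ≤
      1 + expectedSwitches (counterGraph n r s t) F B

section Counting

/-- The loss after `e` has been picked: every edge of a `b`-path of `N` costs a level, but those of
the levels in `T` open a second way to set the next bit, which saves a discount factor `K`. -/
noncomputable def countingLoss (h : ℝ) (q : ℕ) (N T : Finset (Fin n))
    (F : Finset (CEdge n r s t)) (e : CEdge n r s t) : ℝ :=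
  P.loss h q N (F.erase e) + (if e ∈ bEdges r s t N then 1 / P.S else 0) -
    if e ∈ bEdges r s t T then (1 - P.K⁻¹) * P.loss h q N F else 0

theorem sum_countingLoss_le {T : Finset (Fin n)} {A : Finset (CEdge n r s t)} (h0 : 0 ≤ h)
    (q : ℕ) (hN : bEdges r s t N ⊆ A) (hT : bEdges r s t T ⊆ A) (hcard : T.card = P.g) :
    ∑ e ∈ A, P.countingLoss h q N T F e ≤ A.card * P.loss h q N F := by
  set W := P.loss h q N F with hW
  have hW4 : 1 / 4 ≤ W := P.one_div_four_le_loss h0 q N F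
  have hsum : ∑ e ∈ A, P.countingLoss h q N T F e =
      A.card * W + ∑ e ∈ A, (P.loss h q N (F.erase e) - W) +
        (N.card * (r * s) : ℕ) * (1 / P.S) - (P.g * (r * s) : ℕ) * ((1 - P.K⁻¹) * W) := by
    simp only [countingLoss, Finset.sum_sub_distrib, Finset.sum_add_distrib, ← Finset.sum_filter,
      Finset.filter_mem_eq_inter, Finset.inter_eq_right.2 hN, Finset.inter_eq_right.2 hT,
      Finset.sum_const, nsmul_eq_mul, card_bEdges, hcard, ← hW]
    ring
  have hlost : ((N.card * (r * s) : ℕ) : ℝ) * (1 / P.S) ≤ 4 * n / P.S * (r * s : ℕ) * W := by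
    have hNn : N.card ≤ n := (Finset.card_le_univ N).trans_eq (Fintype.card_fin n)
    have hS := P.S_pos
    calc ((N.card * (r * s) : ℕ) : ℝ) * (1 / P.S) ≤ (n * (r * s) : ℕ) * (1 / P.S) := by gcongr
      _ = 4 * n / P.S * (r * s : ℕ) * (1 / 4) := by push_cast; ring
      _ ≤ _ := by gcongr
  have hdrift := mul_le_mul_of_nonneg_right P.counting_drift (hW4.trans' (by norm_num))
  have herase := P.sum_loss_erase_sub_le h0 q N F A
  have hgain : ((P.g * (r * s) : ℕ) : ℝ) * ((1 - P.K⁻¹) * W) =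
      P.g * (r * s : ℕ) * (1 - P.K⁻¹) * W := by
    rw [Nat.cast_mul]
    ring
  rw [hsum, hgain]
  linarith

theorem countingValue_split (h0 : 0 ≤ h) {y : Fin n} {M : Finset (Fin n)} (hM : M ⊆ N)
    (e : CEdge n r s t) (hq : q ≤ r) :
    (x + 1 : ℕ) * 2 ^ k * (1 - P.K ^ (2 * k + (x + 1)) *
        (P.loss h (r * (k + 1)) N (F.erase e) + 1 / P.S -
          (1 - P.K⁻¹) * P.loss h (r * (k + 1)) N F)) ≤
      P.countingValue k x (h + 1) (N.erase y) (F.erase e) + P.settingValue k q h M F := by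
  set W := P.loss h (r * (k + 1)) N F
  set U := P.loss h (r * (k + 1)) N (F.erase e) + 1 / P.S
  set κ := P.K ^ (2 * k + x)
  have hS := P.S_pos
  have hK := P.K_pos
  have hWU : W ≤ U := (P.loss_le_erase h _ N F e).trans (le_add_of_nonneg_right (by positivity))
  have hcount : x * 2 ^ k * (1 - κ * U) ≤
      P.countingValue k x (h + 1) (N.erase y) (F.erase e) := by
    rw [countingValue, P.loss_add_one]
    gcongr
    exact add_le_add_left (P.loss_mono h le_rfl (Finset.erase_subset y N) _) _
  have hset : 2 ^ k * (1 - κ * U) ≤ P.settingValue k q h M F := by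
    have hq' : r * k + q ≤ r * (k + 1) := by rw [mul_add_one]; omega
    have hκ : P.K ^ (2 * k) ≤ κ := pow_le_pow_right₀ P.one_le_K (Nat.le_add_right _ _)
    have hloss := (P.loss_mono h hq' hM F).trans hWU
    have h0' := P.loss_nonneg h0 (r * k + q) M F
    rw [settingValue]
    gcongr
  have hKW : P.K * (U - (1 - P.K⁻¹) * W) = U + (P.K - 1) * (U - W) := by
    field_simp
    ring
  have hU : U ≤ P.K * (U - (1 - P.K⁻¹) * W) := by
    rw [hKW]
    exact le_add_of_nonneg_right (mul_nonneg (sub_nonneg.2 P.one_le_K) (sub_nonneg.2 hWU))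
  calc _ = (x + 1 : ℕ) * 2 ^ k * (1 - κ * (P.K * (U - (1 - P.K⁻¹) * W))) := by
        rw [← add_assoc, pow_succ, mul_assoc κ]
    _ ≤ (x + 1 : ℕ) * 2 ^ k * (1 - κ * U) := by gcongr
    _ = x * 2 ^ k * (1 - κ * U) + 2 ^ k * (1 - κ * U) := by push_cast; ring
    _ ≤ _ := add_le_add hcount hset

variable {P}

theorem ofReal_countingValue_le_of_erase_b1 {y : Fin n} {j : Fin (r * s)}
    (hP : P.Bound (F.erase (.b1 y j)) B) (hc : Counting F B m N) (h0 : 0 ≤ h)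
    (hN : (P.g : ℝ) * (k + 1) + P.S ≤ N.card + h) (hy : y ∈ N) (x : ℕ) :
    ENNReal.ofReal (P.countingValue k x (h + 1) (N.erase y) (F.erase (.b1 y j))) ≤
      1 + expectedSwitches (counterGraph n r s t) (F.erase (.b1 y j)) B := by
  have hcard : ((N.erase y).card : ℝ) + 1 = N.card := by
    exact_mod_cast Finset.card_erase_add_one hy
  exact hP.counting x (hc.erase_b1 y j) (by linarith) (by linarith)

theorem ofReal_countingValue_add_settingValue_le_pickValue
    (hcalls : (counterGraph n r s t).ForallCalls P.Bound F B) (hc : Counting F B m N)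
    (h0 : 0 ≤ h) (hN : (P.g : ℝ) * (k + 1) + P.S ≤ N.card + h) (hcopies : HasCopies F)
    (hpaths : ∀ x ∈ N, ∃ j, APath F x j) {y : Fin n} (hy : y ∈ N)
    (htop : N.card ≤ {z ∈ N | z < y}.card + P.g) {j : Fin (r * s)} (he : .b1 y j ∈ F \ B)
    (x : ℕ) :
    ENNReal.ofReal (P.countingValue k x (h + 1) (N.erase y) (F.erase (.b1 y j)) +
        P.settingValue k (aPaths F y).card h {z ∈ N | z < y} F) ≤
      CompTree.pickValue (counterGraph n r s t) F B (.b1 y j) := by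
  refine ENNReal.ofReal_add_le.trans (le_trans (add_le_add_left ?_ _)
    (CompTree.le_pickValue_of_both isRanked hcalls.isTree hcalls.subset he fun B' hB' => ?_))
  · exact ofReal_countingValue_le_of_erase_b1 (hcalls.first _ he) hc h0 hN hy x
  · obtain ⟨himp, hset⟩ := hc.switch_b1 hcalls.subset hpaths hy
      ⟨hB'.toIsOptimal, hcopies.erase_b1 y j, P.rs_pos⟩
    refine ⟨himp, (hcalls.second _ he B' hB' himp).setting hset h0 ?_ (hpaths y hy)⟩
    have htop' : (N.card : ℝ) ≤ ({z ∈ N | z < y}.card : ℝ) + P.g := by exact_mod_cast htop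
    linarith

theorem ofReal_countingLoss_le_pickValue_of_mem_bEdges
    (hcalls : (counterGraph n r s t).ForallCalls P.Bound F B) (hc : Counting F B m N)
    (h0 : 0 ≤ h) (hN : (P.g : ℝ) * (k + 1) + P.S ≤ N.card + h) (hcopies : HasCopies F)
    (hpaths : ∀ x ∈ N, ∃ j, APath F x j) {T : Finset (Fin n)}
    (htop : ∀ y ∈ T, N.card ≤ {z ∈ N | z < y}.card + P.g) (he : e ∈ F \ B)
    (heN : e ∈ bEdges r s t N) (x : ℕ) :
    ENNReal.ofReal ((x + 1 : ℕ) * 2 ^ k * (1 - P.K ^ (2 * k + (x + 1)) *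
        P.countingLoss h (r * (k + 1)) N T F e)) ≤
      CompTree.pickValue (counterGraph n r s t) F B e := by
  rw [countingLoss, if_pos heN]
  obtain ⟨y, hy, j, rfl⟩ := mem_bEdges.1 heN
  split_ifs with heT
  · have hyT := htop y (b1_mem_bEdges.1 heT)
    have hqr : (aPaths F y).card ≤ r := (Finset.card_le_univ _).trans_eq (Fintype.card_fin r)
    exact (ENNReal.ofReal_le_ofReal
      (P.countingValue_split h0 (Finset.filter_subset (· < y) N) _ hqr)).trans
      (ofReal_countingValue_add_settingValue_le_pickValue hcalls hc h0 hN hcopies hpaths hy hyT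
        he x)
  · refine (ENNReal.ofReal_le_ofReal ?_).trans
      ((ofReal_countingValue_le_of_erase_b1 (hcalls.first _ he) hc h0 hN hy (x + 1)).trans
        (CompTree.le_pickValue_of_first isRanked hcalls.isTree hcalls.subset he))
    have hK := P.K_pos
    rw [countingValue, P.loss_add_one, sub_zero]
    gcongr
    exact P.loss_mono h le_rfl (Finset.erase_subset y N) _

theorem ofReal_countingValue_le_pickValue_of_notMem_bEdges
    (hcalls : (counterGraph n r s t).ForallCalls P.Bound F B) (hc : Counting F B m N)
    (h0 : 0 ≤ h) (hN : (P.g : ℝ) * (k + 1) + P.S ≤ N.card + h) (hcopies : HasCopies F)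
    (he : e ∈ F \ B) (heN : e ∉ bEdges r s t N) (x : ℕ) :
    ENNReal.ofReal (P.countingValue k x h N (F.erase e)) ≤
      CompTree.pickValue (counterGraph n r s t) F B e := by
  by_cases ha : ∃ y : Fin n, y.val = m ∧ ∃ j, APath F y j ∧ ∃ l, e = .a1 y j l
  · obtain ⟨y, rfl, j, hj, l, rfl⟩ := ha
    refine le_trans ?_ (le_add_self.trans
      (CompTree.le_pickValue_of_both isRanked hcalls.isTree hcalls.subset he
        (b := ENNReal.ofReal (P.countingValue k x h N F)) fun B' hB' => ?_))
    · have hK := P.K_pos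
      rw [countingValue, countingValue]
      gcongr
      exact P.loss_le_erase h _ N F _
    · obtain ⟨himp, hc'⟩ := hc.switch_a1 hcalls.subset hj
        ⟨hB'.toIsOptimal, hcopies.erase_a1 y j l, P.rs_pos⟩
      exact ⟨himp, (hcalls.second _ he B' hB' himp).counting x hc' h0 hN⟩
  · refine le_trans ?_ (CompTree.le_pickValue_of_first isRanked hcalls.isTree hcalls.subset he)
    refine (hcalls.first e he).counting x (hc.erase ?_ ?_) h0 hN
    · exact fun y hy j hej => heN (mem_bEdges.2 ⟨y, hy, j, hej⟩)
    · exact fun y hy j hj l hel => ha ⟨y, hy, j, hj, l, hel⟩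

theorem counting_step (hcalls : (counterGraph n r s t).ForallCalls P.Bound F B)
    (hc : Counting F B m N) (h0 : 0 ≤ h) (hN : (P.g : ℝ) * (k + 1) + P.S ≤ N.card + h) (x : ℕ) :
    ENNReal.ofReal (P.countingValue k x h N F) ≤
      1 + expectedSwitches (counterGraph n r s t) F B := by
  rcases le_or_gt (P.countingValue k x h N F) 0 with hneg | hpos
  · exact (ENNReal.ofReal_of_nonpos hneg).trans_le zero_le
  obtain _ | x := x
  · simp [countingValue] at hpos
  have hloss := loss_lt_one_of_pos (by positivity) h0 hpos
  have hcopies := hasCopies_of_loss_lt_one h0 hloss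
  have hpaths := exists_aPath_of_loss_lt_one h0 hloss
  have hg : P.g ≤ N.card := by
    have hle : (P.g : ℝ) ≤ P.g * (k + 1) :=
      le_mul_of_one_le_right (Nat.cast_nonneg _) (le_add_of_nonneg_left (Nat.cast_nonneg _))
    exact_mod_cast hle.trans (le_card_of_loss_lt_one hloss hN)
  obtain ⟨T, hTN, hTcard, htop⟩ := exists_top_subset N P.g hg
  have hbN : bEdges r s t N ⊆ F \ B := by
    intro e he
    obtain ⟨y, hy, j, rfl⟩ := mem_bEdges.1 he
    exact Finset.mem_sdiff.2 ⟨hc.bPath y hy j, hc.b1_notMem y hy j⟩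
  have hbT : bEdges r s t T ⊆ bEdges r s t N :=
    Finset.image_subset_image (Finset.product_subset_product_left hTN)
  have hne : F ≠ B := by
    rintro rfl
    obtain ⟨y, hy⟩ := Finset.card_pos.1 (P.g_pos.trans_le hg)
    exact hc.b1_notMem y hy ⟨0, P.rs_pos⟩ (hc.bPath y hy _)
  refine CompTree.ofReal_le_one_add_expectedSwitches isRanked hcalls.isTree hcalls.subset hne
    (card_mul_one_sub_le_sum (by positivity) (pow_nonneg P.K_pos.le _)
      (P.sum_countingLoss_le h0 _ hbN (hbT.trans hbN) hTcard)) fun e he => ?_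
  by_cases heN : e ∈ bEdges r s t N
  · exact ofReal_countingLoss_le_pickValue_of_mem_bEdges hcalls hc h0 hN hcopies hpaths htop he
      heN x
  · rw [countingLoss, if_neg heN, if_neg fun heT => heN (hbT heT), add_zero, sub_zero]
    exact ofReal_countingValue_le_pickValue_of_notMem_bEdges hcalls hc h0 hN hcopies he heN (x + 1)

end Counting

section Setting

theorem pathWeight_erase_of_setting (p : ℝ) (hs : Setting F B i N) (he : e ∈ F \ B) :
    pathWeight p N (F.erase e) = pathWeight p N F := by
  refine Finset.sum_congr rfl fun y hy => ?_
  rw [aPaths_erase_of_notMem fun hey => ?_]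
  obtain ⟨j, hj, k, rfl⟩ := mem_aEdges.1 hey
  exact (Finset.mem_sdiff.1 he).2 (hs.aPath y hy j (mem_aPaths.1 hj) k)

theorem loss_erase_le_of_setting (hs : Setting F B i N) (he : e ∈ F \ B) (h : ℝ) (q : ℕ) :
    P.loss h (q + (aPaths (F.erase e) i).card) N (F.erase e) ≤
      P.loss h (q + (aPaths F i).card) N F +
        P.η ^ (q + (aPaths F i).card) * (copyWeight P.p (F.erase e) - copyWeight P.p F) -
        if e ∈ aEdges s t i (aPaths F i) then
          (1 - P.η⁻¹) * (P.η ^ (q + (aPaths F i).card) * copyWeight P.p F) else 0 := by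
  rw [loss, loss, pathWeight_erase_of_setting P.p hs he]
  split_ifs with ha
  · obtain ⟨j, hj, k, rfl⟩ := mem_aEdges.1 ha
    have hη := P.η_pos
    have hcopy := copyWeight_le_erase P.p_pos.le P.p_le F (.a1 i j k)
    rw [aPaths_erase_a1, ← Finset.card_erase_add_one hj, ← add_assoc, pow_succ]
    set c := P.η ^ (q + ((aPaths F i).erase j).card)
    have hc : 0 ≤ c * (P.η - 1) :=
      mul_nonneg (pow_nonneg hη.le _) (sub_nonneg.2 P.one_le_η)
    have hgain := mul_le_mul_of_nonneg_left hcopy hc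
    have hinv : (1 - P.η⁻¹) * (c * P.η * copyWeight P.p F) =
        c * (P.η - 1) * copyWeight P.p F := by field_simp
    rw [hinv]
    linarith
  · rw [aPaths_erase_of_notMem ha]
    linarith

theorem sum_loss_erase_le_of_setting (hs : Setting F B i N) (hi : ∃ j, APath F i j) (h : ℝ)
    (q : ℕ) :
    ∑ e ∈ F \ B, P.loss h (q + (aPaths (F.erase e) i).card) N (F.erase e) ≤
      (F \ B).card * P.loss h (q + (aPaths F i).card) N F := by
  set H := P.η ^ (q + (aPaths F i).card) with hH
  have hH0 : 0 < H := pow_pos P.η_pos _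
  have hHC : 0 ≤ H * copyWeight P.p F := P.η_pow_mul_copyWeight_nonneg _ F
  have hsub : aEdges s t i (aPaths F i) ⊆ F \ B := by
    intro e he
    obtain ⟨j, hj, k, rfl⟩ := mem_aEdges.1 he
    exact Finset.mem_sdiff.2 ⟨mem_aPaths.1 hj k, hs.a1_notMem j k⟩
  have hcopy : H * ∑ e ∈ F \ B, (copyWeight P.p (F.erase e) - copyWeight P.p F) ≤
      H * (t * (P.p⁻¹ * copyWeight P.p F)) := by
    gcongr
    exact sum_copyWeight_erase_sub_le P.p_pos P.p_le F (F \ B)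
  have hdrift := mul_le_mul_of_nonneg_right P.setting_drift hHC
  have hη : 0 ≤ 1 - P.η⁻¹ := sub_nonneg.2 (inv_le_one_of_one_le₀ P.one_le_η)
  have hgain : (s : ℝ) * (1 - P.η⁻¹) * (H * copyWeight P.p F) ≤
      ((aPaths F i).card * s : ℕ) * ((1 - P.η⁻¹) * (H * copyWeight P.p F)) := by
    obtain ⟨j, hj⟩ := hi
    rw [mul_assoc]
    gcongr
    exact Nat.le_mul_of_pos_left s (Finset.card_pos.2 ⟨j, mem_aPaths.2 hj⟩)
  refine (Finset.sum_le_sum fun e he => P.loss_erase_le_of_setting hs he h q).trans ?_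
  rw [Finset.sum_sub_distrib, Finset.sum_add_distrib, Finset.sum_const, nsmul_eq_mul,
    ← Finset.mul_sum, ← Finset.sum_filter, Finset.filter_mem_eq_inter,
    Finset.inter_eq_right.2 hsub, Finset.sum_const, nsmul_eq_mul, card_aEdges, ← hH]
  linarith

variable {P}

theorem ofReal_settingValue_le_pickValue_of_b1
    (hcalls : (counterGraph n r s t).ForallCalls P.Bound F B) (hs : Setting F B i N)
    (h0 : 0 ≤ h) (hN : (P.g : ℝ) * k + P.S ≤ N.card + h) (hi : ∃ j, APath F i j)
    (hcopies : HasCopies F) (hpaths : ∀ x ∈ N, ∃ j, APath F x j) {j : Fin (r * s)}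
    (he : .b1 i j ∈ F \ B) :
    ENNReal.ofReal (P.settingValue k (aPaths (F.erase (.b1 i j)) i).card h N
        (F.erase (.b1 i j))) ≤
      CompTree.pickValue (counterGraph n r s t) F B (.b1 i j) := by
  have hvalue : P.settingValue k (aPaths (F.erase (.b1 i j)) i).card h N (F.erase (.b1 i j)) ≤
      P.settingValue k (aPaths F i).card h N F := by
    have hK := P.K_pos
    rw [aPaths_erase_of_notMem fun ha => ?_, settingValue, settingValue]
    · gcongr
      exact P.loss_le_erase h _ N F _
    · obtain ⟨j', -, k', hj'⟩ := mem_aEdges.1 ha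
      cases hj'
  refine (ENNReal.ofReal_le_ofReal hvalue).trans (le_add_self.trans
    (CompTree.le_pickValue_of_both isRanked hcalls.isTree hcalls.subset he fun B' hB' => ?_))
  obtain ⟨himp, hs'⟩ := hs.switch_b1 hcalls.subset hpaths
    ⟨hB'.toIsOptimal, hcopies.erase_b1 i j, P.rs_pos⟩
  exact ⟨himp, (hcalls.second _ he B' hB' himp).setting hs' h0 hN hi⟩

theorem ofReal_settingValue_le_pickValue_of_last_aPath
    (hcalls : (counterGraph n r s t).ForallCalls P.Bound F B) (hs : Setting F B i N)
    (h0 : 0 ≤ h) (hN : (P.g : ℝ) * (k + 1) + P.S ≤ N.card + h) (hcopies : HasCopies F)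
    {j : Fin r} (hj : aPaths F i = {j}) {l : Fin s} (he : .a1 i j l ∈ F \ B) :
    ENNReal.ofReal (P.settingValue (k + 1) (aPaths (F.erase (.a1 i j l)) i).card h N
        (F.erase (.a1 i j l))) ≤
      CompTree.pickValue (counterGraph n r s t) F B (.a1 i j l) := by
  have hvalue : P.settingValue (k + 1) (aPaths (F.erase (.a1 i j l)) i).card h N
      (F.erase (.a1 i j l)) ≤ P.countingValue k 2 h N F := by
    have hK := P.K_pos
    rw [aPaths_erase_a1, hj, Finset.erase_singleton, Finset.card_empty, settingValue,
      countingValue, add_zero, pow_succ', Nat.cast_ofNat, mul_add_one]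
    gcongr
    exact P.loss_le_erase h _ N F _
  refine (ENNReal.ofReal_le_ofReal hvalue).trans (le_add_self.trans
    (CompTree.le_pickValue_of_both isRanked hcalls.isTree hcalls.subset he fun B' hB' => ?_))
  have haPath : ∀ j', APath F i j' ↔ j' = j := fun j' => by
    rw [← mem_aPaths, hj, Finset.mem_singleton]
  obtain ⟨himp, hc⟩ := hs.switch_a1 hcalls.subset ((haPath j).2 rfl) (fun j' => (haPath j').1)
    ⟨hB'.toIsOptimal, hcopies.erase_a1 i j l, P.rs_pos⟩
  exact ⟨himp, (hcalls.second _ he B' hB' himp).counting 2 hc h0 hN⟩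

theorem ofReal_settingValue_le_pickValue
    (hcalls : (counterGraph n r s t).ForallCalls P.Bound F B) (hs : Setting F B i N)
    (h0 : 0 ≤ h) (hN : (P.g : ℝ) * (k + 1) + P.S ≤ N.card + h) (hi : ∃ j, APath F i j)
    (hcopies : HasCopies F) (hpaths : ∀ x ∈ N, ∃ j, APath F x j) (he : e ∈ F \ B) :
    ENNReal.ofReal (P.settingValue (k + 1) (aPaths (F.erase e) i).card h N (F.erase e)) ≤
      CompTree.pickValue (counterGraph n r s t) F B e := by
  have hN' : (P.g : ℝ) * (k + 1 : ℕ) + P.S ≤ N.card + h := by exact_mod_cast hN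
  by_cases hb : ∃ j, e = .b1 i j
  · obtain ⟨j, rfl⟩ := hb
    exact ofReal_settingValue_le_pickValue_of_b1 hcalls hs h0 hN' hi hcopies hpaths he
  push Not at hb
  rcases (aPaths (F.erase e) i).eq_empty_or_nonempty with hlast | ⟨j, hj⟩
  · have ha : e ∈ aEdges s t i (aPaths F i) := by
      by_contra ha
      obtain ⟨j, hj⟩ := hi
      rw [aPaths_erase_of_notMem ha] at hlast
      exact Finset.notMem_empty j (hlast ▸ mem_aPaths.2 hj)
    obtain ⟨j, hj, l, rfl⟩ := mem_aEdges.1 ha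
    rw [aPaths_erase_a1, Finset.erase_eq_empty_iff] at hlast
    exact ofReal_settingValue_le_pickValue_of_last_aPath hcalls hs h0 hN hcopies
      (hlast.resolve_left (Finset.ne_empty_of_mem hj)) he
  · exact ((hcalls.first e he).setting (hs.erase hb) h0 hN' ⟨j, mem_aPaths.1 hj⟩).trans
      (CompTree.le_pickValue_of_first isRanked hcalls.isTree hcalls.subset he)

theorem setting_step (hcalls : (counterGraph n r s t).ForallCalls P.Bound F B)
    (hs : Setting F B i N) (h0 : 0 ≤ h) (hN : (P.g : ℝ) * k + P.S ≤ N.card + h)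
    (hi : ∃ j, APath F i j) :
    ENNReal.ofReal (P.settingValue k (aPaths F i).card h N F) ≤
      1 + expectedSwitches (counterGraph n r s t) F B := by
  rcases le_or_gt (P.settingValue k (aPaths F i).card h N F) 0 with hneg | hpos
  · exact (ENNReal.ofReal_of_nonpos hneg).trans_le zero_le
  obtain _ | k := k
  · refine (ENNReal.ofReal_le_one.2 ?_).trans le_self_add
    have := P.loss_nonneg h0 (r * 0 + (aPaths F i).card) N F
    rw [settingValue, pow_zero, mul_zero, pow_zero]
    linarith
  have hloss := loss_lt_one_of_pos (by positivity) h0 hpos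
  have hne : F ≠ B := by
    rintro rfl
    obtain ⟨j, hj⟩ := hi
    have hs0 : 0 < s := Nat.pos_of_mul_pos_left P.rs_pos
    exact hs.a1_notMem j ⟨0, hs0⟩ (hj _)
  rw [Nat.cast_succ] at hN
  exact CompTree.ofReal_le_one_add_expectedSwitches isRanked hcalls.isTree hcalls.subset hne
    (card_mul_one_sub_le_sum (by positivity) (pow_nonneg P.K_pos.le _)
      (P.sum_loss_erase_le_of_setting hs hi h _)) fun e he =>
    ofReal_settingValue_le_pickValue hcalls hs h0 hN hi (hasCopies_of_loss_lt_one h0 hloss)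
      (exists_aPath_of_loss_lt_one h0 hloss) he

end Setting

theorem bound (hB : (counterGraph n r s t).IsTree B) (hF : B ⊆ F) : P.Bound F B :=
  isRanked.forallCalls_induction
    (fun _ _ hcalls =>
      { counting := fun x _ hc h0 hN => counting_step hcalls hc h0 hN x
        setting := fun hs h0 hN hi => setting_step hcalls hs h0 hN hi }) hB hF

end Params

end CounterGraph

namespace CounterGraph

variable {n r s t : ℕ}

section EdgeCount

theorem numEdges_eq (n r s t : ℕ) :
    numEdges n r s t = n * (2 * (r * s) + 2 * (r * s * t) + 3 * t + r * t) := by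
  rw [numEdges, ← Fintype.card_congr (proxy_equiv% (CEdge n r s t))]
  simp only [Fintype.card_sum, Fintype.card_sigma, Fintype.card_fin, Finset.sum_const,
    Finset.card_univ, smul_eq_mul]
  ring

theorem mul_le_numEdges (n r s t : ℕ) : n * (r * s * t) ≤ numEdges n r s t := by
  rw [numEdges_eq]
  gcongr
  omega

theorem numEdges_le_mul (hr : 0 < r) (hs : 0 < s) (ht : 0 < t) :
    numEdges n r s t ≤ 8 * (n * (r * s * t)) := by
  have hrs : r * s ≤ r * s * t := Nat.le_mul_of_pos_right _ ht
  have ht' : t ≤ r * s * t := Nat.le_mul_of_pos_left _ (Nat.mul_pos hr hs)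
  have hrt : r * t ≤ r * s * t := Nat.mul_le_mul_right _ (Nat.le_mul_of_pos_right _ hs)
  calc numEdges n r s t = n * (2 * (r * s) + 2 * (r * s * t) + 3 * t + r * t) := numEdges_eq n r s t
    _ ≤ n * (8 * (r * s * t)) := Nat.mul_le_mul_left n (by omega)
    _ = 8 * (n * (r * s * t)) := by ring

theorem card_multiEdge_le_numEdges (ht : 0 < t) :
    Fintype.card (MultiEdge n r s) ≤ numEdges n r s t := by
  refine Fintype.card_le_of_injective (fun m => m.copy (⟨0, ht⟩ : Fin t)) fun m m' h => ?_
  cases m <;> cases m' <;> simp_all [MultiEdge.copy]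

end EdgeCount

theorem copyWeight_univ (p : ℝ) :
    copyWeight p (Finset.univ : Finset (CEdge n r s t)) =
      Fintype.card (MultiEdge n r s) * p ^ t := by
  simp [copyWeight, copies]

theorem pathWeight_univ (p : ℝ) :
    pathWeight p Finset.univ (Finset.univ : Finset (CEdge n r s t)) = n * p ^ r := by
  simp [pathWeight, aPaths, APath]

theorem Params.two_pow_mul_le_one_add_expectedSwitches (P : Params n r s t) {k : ℕ}
    (hN : (P.g : ℝ) * (k + 1) + P.S ≤ n) {B₀ : Finset (CEdge n r s t)}
    (hB : (counterGraph n r s t).IsTree B₀) (h0 : ∀ e ∈ B₀, e.IsZero) :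
    ENNReal.ofReal (2 ^ (k + 1) * (1 - P.K ^ (2 * (k + 1)) * (1 / 4 + n * P.p ^ r +
      P.η ^ (r * (k + 1)) * (Fintype.card (MultiEdge n r s) * P.p ^ t)))) ≤
      1 + expectedSwitches (counterGraph n r s t) Finset.univ B₀ := by
  have h := (P.bound hB (Finset.subset_univ _)).counting 2 (counting_univ h0) le_rfl
    (by simpa using hN)
  rw [countingValue, loss, pathWeight_univ, copyWeight_univ, zero_div, add_zero] at h
  convert h using 2
  push_cast
  ring

section Constants

/-- The weight `p` of the potentials: it is small enough for `p ^ q ≤ n ^ (-8)` to hold as soon as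
`log n ≤ C q`. -/
noncomputable def decay (C : ℝ) : ℝ := Real.exp (-(8 * C))

/-- The growth rate of the potentials that the discount per bit has to make up for. -/
noncomputable def driftRate (C : ℝ) : ℝ := 16 + 2 * (decay C)⁻¹

/-- The number of candidate levels per bit, relative to the number of bits. -/
noncomputable def candidateFactor (C : ℝ) : ℕ := ⌈4 * driftRate C⌉₊

/-- The ratio of `√n` and the number of bits that the counter is run with. -/
noncomputable def bitScale (C : ℝ) : ℝ := 2 * C ^ 3 * (decay C)⁻¹ + 2 * candidateFactor C

theorem decay_pos (C : ℝ) : 0 < decay C := Real.exp_pos _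

theorem decay_le_one {C : ℝ} (hC : 0 ≤ C) : decay C ≤ 1 := Real.exp_le_one_iff.2 (by linarith)

theorem driftRate_pos (C : ℝ) : 0 < driftRate C := by
  have h := decay_pos C
  rw [driftRate]
  positivity

theorem mul_driftRate_le_candidateFactor (C : ℝ) : 4 * driftRate C ≤ candidateFactor C :=
  Nat.le_ceil _

theorem candidateFactor_pos (C : ℝ) : 0 < candidateFactor C :=
  Nat.ceil_pos.2 (mul_pos four_pos (driftRate_pos C))

theorem mul_inv_decay_le_bitScale (C : ℝ) : 2 * C ^ 3 * (decay C)⁻¹ ≤ bitScale C :=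
  le_add_of_nonneg_right (by positivity)

theorem mul_candidateFactor_le_bitScale {C : ℝ} (hC : 0 ≤ C) :
    2 * candidateFactor C ≤ bitScale C := by
  have h := decay_pos C
  exact le_add_of_nonneg_left (by positivity)

theorem two_le_bitScale {C : ℝ} (hC : 0 ≤ C) : 2 ≤ bitScale C := by
  have h : (1 : ℝ) ≤ candidateFactor C := by exact_mod_cast candidateFactor_pos C
  linarith [mul_candidateFactor_le_bitScale hC]

end Constants

/-- Explicit bounds, with the constant `C`, for the growth of the parameters of `G_{n,r,s,t}`. -/
structure GrowthBounds (C : ℝ) (n r s t : ℕ) : Prop where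
  one_le : 1 ≤ C
  le_log : C ≤ Real.log n
  mul_log_le : 2 * C * Real.log n ≤ √n
  le_r : C⁻¹ * Real.log n ≤ r
  r_le : r ≤ C * Real.log n
  le_s : C⁻¹ * (√n * Real.log n) ≤ s
  s_le : s ≤ C * (√n * Real.log n)
  le_t : C⁻¹ * Real.log n ≤ t
  t_le : t ≤ C * Real.log n

namespace GrowthBounds

variable {C : ℝ}

theorem pos (hb : GrowthBounds C n r s t) : 0 < C := one_pos.trans_le hb.one_le

theorem one_le_log (hb : GrowthBounds C n r s t) : 1 ≤ Real.log n := hb.one_le.trans hb.le_log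

theorem log_pos (hb : GrowthBounds C n r s t) : 0 < Real.log n := one_pos.trans_le hb.one_le_log

theorem one_le_inv_mul_log (hb : GrowthBounds C n r s t) : 1 ≤ C⁻¹ * Real.log n :=
  (le_inv_mul_iff₀ hb.pos).2 ((mul_one C).trans_le hb.le_log)

theorem two_le_sqrt (hb : GrowthBounds C n r s t) : 2 ≤ √n := by
  have h := one_le_mul_of_one_le_of_one_le hb.one_le hb.one_le_log
  linarith [hb.mul_log_le]

theorem sqrt_pos (hb : GrowthBounds C n r s t) : 0 < √(n : ℝ) := two_pos.trans_le hb.two_le_sqrt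

theorem cast_n_pos (hb : GrowthBounds C n r s t) : (0 : ℝ) < n := Real.sqrt_pos.1 hb.sqrt_pos

theorem two_le_n (hb : GrowthBounds C n r s t) : (2 : ℝ) ≤ n := by
  have h := (Real.le_sqrt' two_pos).1 hb.two_le_sqrt
  linarith

theorem one_le_r (hb : GrowthBounds C n r s t) : (1 : ℝ) ≤ r := hb.one_le_inv_mul_log.trans hb.le_r

theorem one_le_t (hb : GrowthBounds C n r s t) : (1 : ℝ) ≤ t := hb.one_le_inv_mul_log.trans hb.le_t

theorem one_le_s (hb : GrowthBounds C n r s t) : (1 : ℝ) ≤ s :=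
  calc (1 : ℝ) ≤ √n * (C⁻¹ * Real.log n) :=
        one_le_mul_of_one_le_of_one_le (one_le_two.trans hb.two_le_sqrt) hb.one_le_inv_mul_log
    _ = C⁻¹ * (√n * Real.log n) := by ring
    _ ≤ s := hb.le_s

theorem t_pos (hb : GrowthBounds C n r s t) : 0 < t :=
  Nat.cast_pos.1 (one_pos.trans_le hb.one_le_t)

theorem r_pos (hb : GrowthBounds C n r s t) : 0 < r :=
  Nat.cast_pos.1 (one_pos.trans_le hb.one_le_r)

theorem s_pos (hb : GrowthBounds C n r s t) : 0 < s :=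
  Nat.cast_pos.1 (one_pos.trans_le hb.one_le_s)

section EdgeCount

theorem pow_three_le_numEdges (hb : GrowthBounds C n r s t) :
    (C⁻¹ * (√n * Real.log n)) ^ 3 ≤ numEdges n r s t := by
  have hC := hb.pos
  have hlog := hb.log_pos
  calc (C⁻¹ * (√n * Real.log n)) ^ 3
      = √n ^ 2 * ((C⁻¹ * Real.log n) * (C⁻¹ * (√n * Real.log n)) * (C⁻¹ * Real.log n)) := by ring
    _ ≤ (n * (r * s * t) : ℝ) := by
        rw [Real.sq_sqrt n.cast_nonneg]
        gcongr
        exacts [hb.le_r, hb.le_s, hb.le_t]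
    _ ≤ (numEdges n r s t : ℝ) := by exact_mod_cast mul_le_numEdges n r s t

theorem numEdges_le_pow_three (hb : GrowthBounds C n r s t) :
    (numEdges n r s t : ℝ) ≤ (2 * C * (√n * Real.log n)) ^ 3 := by
  have hC := hb.pos
  have hlog := hb.log_pos
  calc (numEdges n r s t : ℝ) ≤ 8 * (n * (r * s * t)) := by
        exact_mod_cast numEdges_le_mul (n := n) hb.r_pos hb.s_pos hb.t_pos
    _ ≤ 8 * (√n ^ 2 * ((C * Real.log n) * (C * (√n * Real.log n)) * (C * Real.log n))) := by
        rw [Real.sq_sqrt n.cast_nonneg]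
        gcongr
        exacts [hb.r_le, hb.s_le, hb.t_le]
    _ = (2 * C * (√n * Real.log n)) ^ 3 := by ring

theorem numEdges_le_n_pow_three (hb : GrowthBounds C n r s t) :
    (numEdges n r s t : ℝ) ≤ n ^ 3 := by
  have hC := hb.pos
  have hlog := hb.log_pos
  refine hb.numEdges_le_pow_three.trans (pow_le_pow_left₀ (by positivity) ?_ 3)
  calc 2 * C * (√n * Real.log n) = √n * (2 * C * Real.log n) := by ring
    _ ≤ √n * √n := by gcongr; exact hb.mul_log_le
    _ = n := Real.mul_self_sqrt n.cast_nonneg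

theorem n_le_numEdges (hb : GrowthBounds C n r s t) : (n : ℝ) ≤ numEdges n r s t := by
  have h : 0 < r * s * t := Nat.mul_pos (Nat.mul_pos hb.r_pos hb.s_pos) hb.t_pos
  exact_mod_cast (Nat.le_mul_of_pos_right n h).trans (mul_le_numEdges n r s t)

theorem log_n_le_log_numEdges (hb : GrowthBounds C n r s t) :
    Real.log n ≤ Real.log (numEdges n r s t) :=
  Real.log_le_log hb.cast_n_pos hb.n_le_numEdges

theorem log_numEdges_le (hb : GrowthBounds C n r s t) :
    Real.log (numEdges n r s t) ≤ 3 * Real.log n := by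
  have h := Real.log_le_log (hb.cast_n_pos.trans_le hb.n_le_numEdges) hb.numEdges_le_n_pow_three
  rwa [Real.log_pow] at h

theorem log_numEdges_pos (hb : GrowthBounds C n r s t) : 0 < Real.log (numEdges n r s t) :=
  hb.log_pos.trans_le hb.log_n_le_log_numEdges

theorem le_numEdges_rpow (hb : GrowthBounds C n r s t) :
    C⁻¹ * (√n * Real.log n) ≤ (numEdges n r s t : ℝ) ^ (1 / 3 : ℝ) := by
  have hC := hb.pos
  have hlog := hb.log_pos
  rw [one_div, Real.le_rpow_inv_iff_of_pos (by positivity) (by positivity) three_pos]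
  exact_mod_cast hb.pow_three_le_numEdges

theorem numEdges_rpow_le (hb : GrowthBounds C n r s t) :
    (numEdges n r s t : ℝ) ^ (1 / 3 : ℝ) ≤ 2 * C * (√n * Real.log n) := by
  have hC := hb.pos
  have hlog := hb.log_pos
  rw [one_div, Real.rpow_inv_le_iff_of_pos (by positivity) (by positivity) three_pos]
  exact_mod_cast hb.numEdges_le_pow_three

theorem le_numEdges_rpow_div_log (hb : GrowthBounds C n r s t) :
    (3 * C)⁻¹ * √n ≤ (numEdges n r s t : ℝ) ^ (1 / 3 : ℝ) / Real.log (numEdges n r s t) := by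
  have hC := hb.pos
  rw [le_div_iff₀ hb.log_numEdges_pos]
  calc (3 * C)⁻¹ * √n * Real.log (numEdges n r s t)
      ≤ (3 * C)⁻¹ * √n * (3 * Real.log n) := by gcongr; exact hb.log_numEdges_le
    _ = C⁻¹ * (√n * Real.log n) := by field_simp
    _ ≤ (numEdges n r s t : ℝ) ^ (1 / 3 : ℝ) := hb.le_numEdges_rpow

theorem numEdges_rpow_div_log_le (hb : GrowthBounds C n r s t) :
    (numEdges n r s t : ℝ) ^ (1 / 3 : ℝ) / Real.log (numEdges n r s t) ≤ 2 * C * √n := by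
  have hC := hb.pos
  rw [div_le_iff₀ hb.log_numEdges_pos]
  calc (numEdges n r s t : ℝ) ^ (1 / 3 : ℝ) ≤ 2 * C * (√n * Real.log n) := hb.numEdges_rpow_le
    _ = 2 * C * √n * Real.log n := by ring
    _ ≤ 2 * C * √n * Real.log (numEdges n r s t) :=
        mul_le_mul_of_nonneg_left hb.log_n_le_log_numEdges (by positivity)

end EdgeCount

section Counter

variable {k : ℕ}

theorem decay_pow_le (hb : GrowthBounds C n r s t) {q : ℕ} (hq : C⁻¹ * Real.log n ≤ q) :
    decay C ^ q ≤ ((n : ℝ) ^ 8)⁻¹ := by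
  have hexp : ((n : ℝ) ^ 8)⁻¹ = Real.exp (-(8 * Real.log n)) := by
    rw [Real.exp_neg, mul_comm, Real.exp_mul, Real.exp_log hb.cast_n_pos]
    norm_cast
  rw [decay, ← Real.exp_nat_mul, hexp, Real.exp_le_exp]
  linarith [(inv_mul_le_iff₀ hb.pos).1 hq]

theorem bitScale_le_sqrt (hb : GrowthBounds C n r s t) (hk : ((k + 1 : ℕ) : ℝ) * bitScale C ≤ √n) :
    bitScale C ≤ √n := by
  have hA := two_le_bitScale hb.pos.le
  exact (le_mul_of_one_le_left (by linarith) (by exact_mod_cast k.succ_pos)).trans hk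

theorem two_mul_t_div_decay_le_s (hb : GrowthBounds C n r s t)
    (hk : ((k + 1 : ℕ) : ℝ) * bitScale C ≤ √n) : 2 * (t * (decay C)⁻¹) ≤ s := by
  have hp := decay_pos C
  have hC := hb.pos
  have hlog := hb.log_pos
  have hscale : 2 * C ^ 2 * (decay C)⁻¹ ≤ √n :=
    calc 2 * C ^ 2 * (decay C)⁻¹ ≤ 2 * C ^ 3 * (decay C)⁻¹ := by
          gcongr
          exacts [hb.one_le, by norm_num]
      _ ≤ √n := (mul_inv_decay_le_bitScale C).trans (hb.bitScale_le_sqrt hk)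
  calc 2 * (t * (decay C)⁻¹) ≤ 2 * (C * Real.log n * (decay C)⁻¹) := by gcongr; exact hb.t_le
    _ = C⁻¹ * (2 * C ^ 2 * (decay C)⁻¹ * Real.log n) := by field_simp
    _ ≤ C⁻¹ * (√n * Real.log n) := by gcongr
    _ ≤ s := hb.le_s

theorem t_le_r_mul_s (hb : GrowthBounds C n r s t) (hk : ((k + 1 : ℕ) : ℝ) * bitScale C ≤ √n) :
    (t : ℝ) ≤ (r * s : ℕ) := by
  have hp : 1 ≤ (decay C)⁻¹ := (one_le_inv₀ (decay_pos C)).2 (decay_le_one hb.pos.le)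
  calc (t : ℝ) ≤ t * (decay C)⁻¹ := le_mul_of_one_le_right t.cast_nonneg hp
    _ ≤ 2 * (t * (decay C)⁻¹) := le_mul_of_one_le_left (by positivity) one_le_two
    _ ≤ s := hb.two_mul_t_div_decay_le_s hk
    _ ≤ (r * s : ℕ) := by exact_mod_cast Nat.le_mul_of_pos_left s hb.r_pos

theorem t_div_decay_div_s_le (hb : GrowthBounds C n r s t)
    (hk : ((k + 1 : ℕ) : ℝ) * bitScale C ≤ √n) : t * (decay C)⁻¹ / s ≤ 1 / 2 := by
  rw [div_le_iff₀ (one_pos.trans_le hb.one_le_s)]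
  linarith [hb.two_mul_t_div_decay_le_s hk]

end Counter

end GrowthBounds

section Estimates

theorem inv_one_sub_pow_le_two {x : ℝ} (hx : x < 1) {N : ℕ} (h : 2 * (N * x) ≤ 1) :
    ((1 - x)⁻¹) ^ N ≤ 2 := by
  have hbernoulli := one_add_mul_le_pow (a := -x) (by linarith) N
  rw [← sub_eq_add_neg] at hbernoulli
  rw [inv_pow]
  exact inv_le_of_inv_le₀ two_pos (by linarith)

theorem inv_one_sub_pow_le_exp {x : ℝ} (hx0 : 0 ≤ x) (hx : x ≤ 1 / 2) (N : ℕ) :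
    ((1 - x)⁻¹) ^ N ≤ Real.exp (N * (2 * x)) := by
  have hinv : (1 - x)⁻¹ ≤ 2 * x + 1 := by
    rw [inv_le_iff_one_le_mul₀ (by linarith)]
    nlinarith
  rw [Real.exp_nat_mul]
  exact pow_le_pow_left₀ (inv_nonneg.2 (by linarith)) (hinv.trans (Real.add_one_le_exp _)) N

theorem exp_add_one_le_two_pow_div_four {y : ℝ} (hy : 10 ≤ y) {N : ℕ} (hN : 4 * y ≤ N + 1) :
    Real.exp y + 1 ≤ 2 ^ N / 4 := by
  have h2 : Real.exp (1 / 2) ≤ 2 := by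
    rw [← Real.le_log_iff_exp_le two_pos]
    linarith [Real.log_two_gt_d9]
  have h8 : 8 ≤ Real.exp (y - 1 / 2) := by linarith [Real.add_one_le_exp (y - 1 / 2)]
  have h1 : 1 ≤ Real.exp y := Real.one_le_exp (by linarith)
  have hpow : Real.exp y * 8 ≤ 2 ^ N :=
    calc Real.exp y * 8 ≤ Real.exp y * Real.exp (y - 1 / 2) := by gcongr
      _ = Real.exp (y + (y - 1 / 2)) := (Real.exp_add _ _).symm
      _ ≤ Real.exp (N * (1 / 2)) := Real.exp_le_exp.2 (by linarith)
      _ = Real.exp (1 / 2) ^ N := Real.exp_nat_mul _ _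
      _ ≤ 2 ^ N := by gcongr
  linarith

end Estimates

theorem mul_driftRate_div_le_one (C : ℝ) (k : ℕ) :
    4 * ((k + 1 : ℕ) * (driftRate C / (candidateFactor C * (k + 1) : ℕ))) ≤ 1 := by
  have hm : (0 : ℝ) < candidateFactor C := by exact_mod_cast candidateFactor_pos C
  calc 4 * ((k + 1 : ℕ) * (driftRate C / (candidateFactor C * (k + 1) : ℕ)))
      = 4 * driftRate C / candidateFactor C := by
        push_cast
        field_simp
    _ ≤ 1 := (div_le_one hm).2 (mul_driftRate_le_candidateFactor C)

theorem driftRate_div_pos (C : ℝ) (k : ℕ) :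
    0 < driftRate C / (candidateFactor C * (k + 1) : ℕ) := by
  have hm := candidateFactor_pos C
  have hμ := driftRate_pos C
  positivity

theorem driftRate_div_lt_one (C : ℝ) (k : ℕ) :
    driftRate C / (candidateFactor C * (k + 1) : ℕ) < 1 := by
  have h := driftRate_div_pos C k
  have hk : driftRate C / (candidateFactor C * (k + 1) : ℕ) ≤
      (k + 1 : ℕ) * (driftRate C / (candidateFactor C * (k + 1) : ℕ)) :=
    le_mul_of_one_le_left h.le (by exact_mod_cast k.succ_pos)
  linarith [mul_driftRate_div_le_one C k]

namespace GrowthBounds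

variable {C : ℝ} {k : ℕ}

/-- The parameters with which the counter of `G_{n,r,s,t}` counts with `k + 1` bits. The discount
`η` satisfies its drift condition with equality, `K` with `r * s` in place of `t`. -/
noncomputable def params (hb : GrowthBounds C n r s t)
    (hk : ((k + 1 : ℕ) : ℝ) * bitScale C ≤ √n) : Params n r s t where
  p := decay C
  K := (1 - driftRate C / (candidateFactor C * (k + 1) : ℕ))⁻¹
  η := (1 - t * (decay C)⁻¹ / s)⁻¹
  S := n / 4
  g := candidateFactor C * (k + 1)
  p_pos := decay_pos C
  p_le := decay_le_one hb.pos.le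
  one_le_K := (one_le_inv₀ (sub_pos.2 (driftRate_div_lt_one C k))).2
    (sub_le_self _ (driftRate_div_pos C k).le)
  one_le_η := by
    have hp := decay_pos C
    have hz := hb.t_div_decay_div_s_le hk
    exact (one_le_inv₀ (by linarith)).2 (sub_le_self _ (by positivity))
  S_pos := div_pos hb.cast_n_pos four_pos
  g_pos := Nat.mul_pos (candidateFactor_pos C) k.succ_pos
  rs_pos := Nat.mul_pos hb.r_pos hb.s_pos
  counting_drift := by
    have hg : (0 : ℝ) < (candidateFactor C * (k + 1) : ℕ) := by
      exact_mod_cast Nat.mul_pos (candidateFactor_pos C) k.succ_pos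
    have hn := hb.cast_n_pos
    have ht := mul_le_mul_of_nonneg_right (hb.t_le_r_mul_s hk) (inv_nonneg.2 (decay_pos C).le)
    calc (4 * n / (n / 4) + (decay C)⁻¹) * (r * s : ℕ) + t * (decay C)⁻¹
        = (16 + (decay C)⁻¹) * (r * s : ℕ) + t * (decay C)⁻¹ := by
          rw [div_div_eq_mul_div, mul_right_comm, mul_div_cancel_right₀ _ hn.ne']
          norm_num
      _ ≤ driftRate C * (r * s : ℕ) := by
          rw [driftRate]
          linarith
      _ = _ := by
          rw [inv_inv, sub_sub_cancel]
          field_simp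
  setting_drift := by
    have hs : (s : ℝ) ≠ 0 := (one_pos.trans_le hb.one_le_s).ne'
    rw [inv_inv, sub_sub_cancel, mul_div_cancel₀ _ hs]

theorem params_fits (hb : GrowthBounds C n r s t) (hk : ((k + 1 : ℕ) : ℝ) * bitScale C ≤ √n) :
    ((hb.params hk).g : ℝ) * (k + 1) + (hb.params hk).S ≤ n := by
  have hA2 := two_le_bitScale hb.pos.le
  have hA0 : 0 < bitScale C := two_pos.trans_le hA2
  have hA : (2 * candidateFactor C : ℝ) ≤ bitScale C ^ 2 :=
    (mul_candidateFactor_le_bitScale hb.pos.le).trans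
      (le_self_pow₀ (one_le_two.trans hA2) two_ne_zero)
  have hsq : ((k + 1 : ℕ) : ℝ) ^ 2 * (2 * candidateFactor C) ≤ n :=
    calc ((k + 1 : ℕ) : ℝ) ^ 2 * (2 * candidateFactor C)
        ≤ ((k + 1 : ℕ) : ℝ) ^ 2 * bitScale C ^ 2 := by gcongr
      _ = ((k + 1 : ℕ) * bitScale C) ^ 2 := (mul_pow _ _ _).symm
      _ ≤ n := (Real.le_sqrt' (mul_pos (by positivity) hA0)).1 hk
  rw [params]
  push_cast at hsq ⊢
  linarith [hb.cast_n_pos]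

theorem params_K_pow_le (hb : GrowthBounds C n r s t)
    (hk : ((k + 1 : ℕ) : ℝ) * bitScale C ≤ √n) : (hb.params hk).K ^ (2 * (k + 1)) ≤ 2 := by
  refine inv_one_sub_pow_le_two (driftRate_div_lt_one C k) ?_
  rw [Nat.cast_mul 2, Nat.cast_two]
  linarith [mul_driftRate_div_le_one C k]

theorem params_η_pow_le (hb : GrowthBounds C n r s t)
    (hk : ((k + 1 : ℕ) : ℝ) * bitScale C ≤ √n) : (hb.params hk).η ^ (r * (k + 1)) ≤ n := by
  have hp := decay_pos C
  have hC := hb.pos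
  have hlog := hb.log_pos
  have hs : (0 : ℝ) < s := one_pos.trans_le hb.one_le_s
  have hA : 0 < bitScale C := two_pos.trans_le (two_le_bitScale hC.le)
  refine (inv_one_sub_pow_le_exp (by positivity) (hb.t_div_decay_div_s_le hk) _).trans ?_
  rw [← Real.le_log_iff_exp_le hb.cast_n_pos, mul_div_assoc', mul_div_assoc', div_le_iff₀ hs]
  refine le_of_mul_le_mul_right ?_ hA
  calc ((r * (k + 1) : ℕ) : ℝ) * (2 * (t * (decay C)⁻¹)) * bitScale C
      = r * (2 * (t * (decay C)⁻¹)) * ((k + 1 : ℕ) * bitScale C) := by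
        push_cast
        ring
    _ ≤ (C * Real.log n) * (2 * ((C * Real.log n) * (decay C)⁻¹)) * √n := by
        gcongr
        exacts [hb.r_le, hb.t_le]
    _ = Real.log n * (C⁻¹ * (√n * Real.log n)) * (2 * C ^ 3 * (decay C)⁻¹) := by field_simp
    _ ≤ Real.log n * s * bitScale C := by
        gcongr
        exacts [hb.le_s, mul_inv_decay_le_bitScale C]

theorem sixteen_le_n_pow_four (hb : GrowthBounds C n r s t) : (16 : ℝ) ≤ n ^ 4 :=
  calc (16 : ℝ) = 2 ^ 4 := by norm_num
    _ ≤ n ^ 4 := pow_le_pow_left₀ two_pos.le hb.two_le_n 4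

theorem n_mul_decay_pow_r_le (hb : GrowthBounds C n r s t) : n * decay C ^ r ≤ 1 / 16 := by
  have hn := hb.cast_n_pos
  calc n * decay C ^ r ≤ n * ((n : ℝ) ^ 8)⁻¹ := by
        gcongr
        exact hb.decay_pow_le hb.le_r
    _ = ((n : ℝ) ^ 4 * n ^ 3)⁻¹ := by field_simp
    _ ≤ (16 * 1)⁻¹ := by
        gcongr
        exacts [hb.sixteen_le_n_pow_four, one_le_pow₀ (one_le_two.trans hb.two_le_n)]
    _ = 1 / 16 := by norm_num

theorem n_mul_card_mul_decay_pow_t_le (hb : GrowthBounds C n r s t) :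
    n * (Fintype.card (MultiEdge n r s) * decay C ^ t) ≤ 1 / 16 := by
  have hn := hb.cast_n_pos
  have hcard : (Fintype.card (MultiEdge n r s) : ℝ) ≤ n ^ 3 :=
    (Nat.cast_le.2 (card_multiEdge_le_numEdges hb.t_pos)).trans hb.numEdges_le_n_pow_three
  have hp := decay_pos C
  calc n * (Fintype.card (MultiEdge n r s) * decay C ^ t)
      ≤ n * (n ^ 3 * ((n : ℝ) ^ 8)⁻¹) := by
        gcongr
        exact hb.decay_pow_le hb.le_t
    _ = ((n : ℝ) ^ 4)⁻¹ := by field_simp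
    _ ≤ 16⁻¹ := inv_anti₀ (by norm_num) hb.sixteen_le_n_pow_four
    _ = 1 / 16 := by norm_num

theorem params_discounted_loss_le (hb : GrowthBounds C n r s t)
    (hk : ((k + 1 : ℕ) : ℝ) * bitScale C ≤ √n) :
    (hb.params hk).K ^ (2 * (k + 1)) * (1 / 4 + n * (hb.params hk).p ^ r +
      (hb.params hk).η ^ (r * (k + 1)) *
        (Fintype.card (MultiEdge n r s) * (hb.params hk).p ^ t)) ≤ 3 / 4 := by
  have hp := decay_pos C
  have hlevels : n * (hb.params hk).p ^ r ≤ 1 / 16 := hb.n_mul_decay_pow_r_le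
  have hcopies : (hb.params hk).η ^ (r * (k + 1)) *
      (Fintype.card (MultiEdge n r s) * (hb.params hk).p ^ t) ≤ 1 / 16 :=
    (mul_le_mul_of_nonneg_right (hb.params_η_pow_le hk)
      (mul_nonneg (Nat.cast_nonneg _) (pow_nonneg hp.le t))).trans
      hb.n_mul_card_mul_decay_pow_t_le
  calc _ ≤ (hb.params hk).K ^ (2 * (k + 1)) * (3 / 8) :=
        mul_le_mul_of_nonneg_left (by linarith) (pow_nonneg (hb.params hk).K_pos.le _)
    _ ≤ 2 * (3 / 8) := mul_le_mul_of_nonneg_right (hb.params_K_pow_le hk) (by norm_num)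
    _ = 3 / 4 := by norm_num

variable {B₀ : Finset (CEdge n r s t)}

theorem two_pow_div_four_le_one_add_expectedSwitches (hb : GrowthBounds C n r s t)
    (hk : ((k + 1 : ℕ) : ℝ) * bitScale C ≤ √n) (hB : (counterGraph n r s t).IsTree B₀)
    (h0 : ∀ e ∈ B₀, e.IsZero) :
    ENNReal.ofReal (2 ^ (k + 1) / 4) ≤
      1 + expectedSwitches (counterGraph n r s t) Finset.univ B₀ := by
  refine (ENNReal.ofReal_le_ofReal ?_).trans
    ((hb.params hk).two_pow_mul_le_one_add_expectedSwitches (hb.params_fits hk) hB h0)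
  rw [div_eq_mul_one_div]
  gcongr
  linarith [hb.params_discounted_loss_le hk]

theorem ofReal_exp_le_expectedSwitches (hb : GrowthBounds C n r s t)
    (hn : 40 * bitScale C ≤ √n) (hB : (counterGraph n r s t).IsTree B₀)
    (h0 : ∀ e ∈ B₀, e.IsZero) :
    ENNReal.ofReal (Real.exp ((4 * bitScale C)⁻¹ * √n)) ≤
      expectedSwitches (counterGraph n r s t) Finset.univ B₀ := by
  have hA : 0 < bitScale C := two_pos.trans_le (two_le_bitScale hb.pos.le)
  have hfloor : 0 < ⌊√n / bitScale C⌋₊ :=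
    Nat.floor_pos.2 ((one_le_div hA).2 (by linarith))
  obtain ⟨k, hk⟩ : ∃ k, ⌊√n / bitScale C⌋₊ = k + 1 := Nat.exists_eq_succ_of_ne_zero hfloor.ne'
  have hkA : ((k + 1 : ℕ) : ℝ) * bitScale C ≤ √n :=
    (le_div_iff₀ hA).1 ((Nat.le_floor_iff (by positivity)).1 hk.ge)
  have hrate : 4 * ((4 * bitScale C)⁻¹ * √n) = √n / bitScale C := by field_simp
  have hexp : Real.exp ((4 * bitScale C)⁻¹ * √n) + 1 ≤ 2 ^ (k + 1) / 4 := by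
    refine exp_add_one_le_two_pow_div_four ((le_inv_mul_iff₀ (by positivity)).2 (by linarith)) ?_
    rw [hrate, ← hk]
    exact (Nat.lt_floor_add_one _).le
  have h := (ENNReal.ofReal_le_ofReal hexp).trans
    (hb.two_pow_div_four_le_one_add_expectedSwitches hkA hB h0)
  rw [ENNReal.ofReal_add (Real.exp_pos _).le zero_le_one, ENNReal.ofReal_one, add_comm] at h
  exact (ENNReal.add_le_add_iff_left ENNReal.one_ne_top).1 h

end GrowthBounds

section Asymptotics

theorem exists_forall_eventually_bounds {f g : ℕ → ℝ} (h : f =Θ[atTop] g) (hf : ∀ n, 0 ≤ f n)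
    (hg : ∀ n, 0 ≤ g n) :
    ∃ C₀ : ℝ, ∀ C ≥ C₀, 0 < C → ∀ᶠ n in atTop, C⁻¹ * g n ≤ f n ∧ f n ≤ C * g n := by
  obtain ⟨c₁, h₁⟩ := h.1.bound
  obtain ⟨c₂, h₂⟩ := h.2.bound
  refine ⟨max c₁ c₂, fun C hC hC0 => ?_⟩
  filter_upwards [h₁, h₂] with n h₁ h₂
  rw [Real.norm_of_nonneg (hf n), Real.norm_of_nonneg (hg n)] at h₁ h₂
  refine ⟨(inv_mul_le_iff₀ hC0).2 (h₂.trans ?_), h₁.trans ?_⟩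
  · exact mul_le_mul_of_nonneg_right ((le_max_right _ _).trans hC) (hf n)
  · exact mul_le_mul_of_nonneg_right ((le_max_left _ _).trans hC) (hg n)

theorem tendsto_log_natCast_atTop : Tendsto (fun n : ℕ => Real.log n) atTop atTop :=
  Real.tendsto_log_atTop.comp tendsto_natCast_atTop_atTop

theorem tendsto_sqrt_natCast_atTop : Tendsto (fun n : ℕ => √(n : ℝ)) atTop atTop :=
  Real.tendsto_sqrt_atTop.comp tendsto_natCast_atTop_atTop

theorem eventually_mul_log_le_sqrt {a : ℝ} (ha : 0 < a) :
    ∀ᶠ n : ℕ in atTop, a * Real.log n ≤ √n := by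
  have h := (isLittleO_log_rpow_atTop (r := 1 / 2) one_half_pos).comp_tendsto
    (tendsto_natCast_atTop_atTop (R := ℝ))
  filter_upwards [h.bound (inv_pos.2 ha)] with n hn
  simp only [Function.comp_apply, ← Real.sqrt_eq_rpow] at hn
  rw [Real.norm_of_nonneg (Real.log_natCast_nonneg n), Real.norm_of_nonneg (Real.sqrt_nonneg _),
    le_inv_mul_iff₀ ha] at hn
  exact hn

theorem exists_eventually_growthBounds {r s t : ℕ → ℕ}
    (hr : (fun n : ℕ => (r n : ℝ)) =Θ[atTop] fun n : ℕ => Real.log n)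
    (hs : (fun n : ℕ => (s n : ℝ)) =Θ[atTop] fun n : ℕ => √n * Real.log n)
    (ht : (fun n : ℕ => (t n : ℝ)) =Θ[atTop] fun n : ℕ => Real.log n) :
    ∃ C : ℝ, ∀ᶠ n : ℕ in atTop, GrowthBounds C n (r n) (s n) (t n) := by
  have hlog : ∀ n : ℕ, 0 ≤ Real.log n := Real.log_natCast_nonneg
  obtain ⟨C₁, h₁⟩ := exists_forall_eventually_bounds hr (fun n => (r n).cast_nonneg) hlog
  obtain ⟨C₂, h₂⟩ := exists_forall_eventually_bounds hs (fun n => (s n).cast_nonneg)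
    fun n => mul_nonneg (Real.sqrt_nonneg _) (hlog n)
  obtain ⟨C₃, h₃⟩ := exists_forall_eventually_bounds ht (fun n => (t n).cast_nonneg) hlog
  obtain ⟨C, hC, hC₁, hC₂, hC₃⟩ : ∃ C : ℝ, 1 ≤ C ∧ C₁ ≤ C ∧ C₂ ≤ C ∧ C₃ ≤ C :=
    ⟨max (max 1 C₁) (max C₂ C₃), by simp, by simp, by simp, by simp⟩
  have hC0 : 0 < C := one_pos.trans_le hC
  refine ⟨C, ?_⟩
  filter_upwards [h₁ C hC₁ hC0, h₂ C hC₂ hC0, h₃ C hC₃ hC0,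
    tendsto_log_natCast_atTop.eventually_ge_atTop C,
    eventually_mul_log_le_sqrt (mul_pos two_pos hC0)] with n hr hs ht hlog hsqrt
  exact ⟨hC, hlog, hsqrt, hr.1, hr.2, hs.1, hs.2, ht.1, ht.2⟩

theorem isTheta_sqrt_numEdges {r s t : ℕ → ℕ} {C : ℝ}
    (hC : ∀ᶠ n : ℕ in atTop, GrowthBounds C n (r n) (s n) (t n)) :
    (fun n : ℕ => √(n : ℝ)) =Θ[atTop] fun n : ℕ =>
      (numEdges n (r n) (s n) (t n) : ℝ) ^ (1 / 3 : ℝ) /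
        Real.log (numEdges n (r n) (s n) (t n)) := by
  refine ⟨IsBigO.of_bound (3 * C) ?_, IsBigO.of_bound (2 * C) ?_⟩
  · filter_upwards [hC] with n hb
    have h3C : 0 < 3 * C := mul_pos three_pos hb.pos
    rw [Real.norm_of_nonneg (Real.sqrt_nonneg _)]
    exact ((inv_mul_le_iff₀ h3C).1 hb.le_numEdges_rpow_div_log).trans
      (mul_le_mul_of_nonneg_left (Real.le_norm_self _) h3C.le)
  · filter_upwards [hC] with n hb
    rw [Real.norm_of_nonneg (Real.sqrt_nonneg _), Real.norm_of_nonneg]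
    · exact hb.numEdges_rpow_div_log_le
    · exact div_nonneg (Real.rpow_nonneg (Nat.cast_nonneg _) _) hb.log_numEdges_pos.le

end Asymptotics

end CounterGraph

theorem theorem1 (r s t : ℕ → ℕ)
    (hr : (fun n : ℕ => (r n : ℝ)) =Θ[atTop] fun n : ℕ => Real.log n)
    (hs : (fun n : ℕ => (s n : ℝ)) =Θ[atTop] fun n : ℕ => Real.sqrt n * Real.log n)
    (ht : (fun n : ℕ => (t n : ℝ)) =Θ[atTop] fun n : ℕ => Real.log n) :
    ((fun n : ℕ => Real.sqrt n) =Θ[atTop] fun n : ℕ =>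
      (numEdges n (r n) (s n) (t n) : ℝ) ^ (1 / 3 : ℝ) /
        Real.log (numEdges n (r n) (s n) (t n))) ∧
    ∃ c : ℝ, 0 < c ∧ ∀ᶠ n : ℕ in atTop,
      ∀ B₀ : Finset (CEdge n (r n) (s n) (t n)),
        (counterGraph n (r n) (s n) (t n)).IsTree B₀ → (∀ e ∈ B₀, e.IsZero) →
          ENNReal.ofReal (Real.exp (c * Real.sqrt n)) ≤
              expectedSwitches (counterGraph n (r n) (s n) (t n)) Finset.univ B₀ ∧
          ENNReal.ofReal (Real.exp (c *
              ((numEdges n (r n) (s n) (t n) : ℝ) ^ (1 / 3 : ℝ) /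
                Real.log (numEdges n (r n) (s n) (t n))))) ≤
              expectedSwitches (counterGraph n (r n) (s n) (t n)) Finset.univ B₀ := by
  obtain ⟨C, hC⟩ := CounterGraph.exists_eventually_growthBounds hr hs ht
  have hC0 : 0 < C := hC.exists.elim fun _ hb => hb.pos
  have hA : 0 < CounterGraph.bitScale C :=
    two_pos.trans_le (CounterGraph.two_le_bitScale hC0.le)
  refine ⟨CounterGraph.isTheta_sqrt_numEdges hC,
    (4 * CounterGraph.bitScale C)⁻¹ / (2 * C), by positivity, ?_⟩
  filter_upwards [hC, CounterGraph.tendsto_sqrt_natCast_atTop.eventually_ge_atTop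
    (40 * CounterGraph.bitScale C)] with n hb hn B₀ hB h0
  have hE := hb.ofReal_exp_le_expectedSwitches hn hB h0
  constructor <;> refine le_trans (ENNReal.ofReal_le_ofReal (Real.exp_le_exp.2 ?_)) hE
  · gcongr
    exact div_le_self (by positivity) (by linarith [hb.one_le])
  · rw [div_mul_eq_mul_div, div_le_iff₀ (by positivity), mul_assoc, mul_comm √(n : ℝ)]
    gcongr
    exact hb.numEdges_rpow_div_log_le
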